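/- **Setting.** A Tanner graph is a finite bipartite graph $G=(\mathcal V\cup\mathcal J,E)$ with $N=|\mathcal V|$ variable nodes and with local-code nodes $\mathcal J$, where the edges at each $C_j\in\mathcal J$ are ordered; each $C_j$ carries a binary linear code $\bar{\mathcal C}^j$ of length $\deg_G(C_j)$. For $j\in\mathcal J$ let $\mathcal C^j\subseteq\{0,1\}^N$ be the set of words whose projection onto the neighbours of $C_j$ lies in $\bar{\mathcal C}^j$. The Tanner code is $\mathcal C=\bigcap_j\mathcal C^j$, the generalized fundamental polytope is $\mathcal P=\bigcap_j\mathrm{conv}(\mathcal C^j)\subseteq\mathbb R^N$, and $d^*$ is the smallest minimum distance of the local codes. LP decoding minimizes $\langle\lambda,x\rangle$ over $x\in\mathcal P$. *Trees.* For $r\in\mathcal V$, the path-prefix tree $\mathcal T_r^{2h}(G)$ has as nodes the backtrackless paths of length at most $2h$ in $G$ starting at $r$, and a path is joined to its one-edge extensions; a node is a variable (local-code) node of the tree if the path ends in $\mathcal V$ (in $\mathcal J$). A *$d$-tree* is a subtree that contains the root, in which local-code nodes have degree $d$ and variable nodes have the same degree as in the whole tree. *Local optimality.* Let $w=(w_1,\dots,w_h)\in\mathbb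 R_{\ge0}^h\setminus\{0^h\}$. In a $d$-tree $\mathcal T$, a variable path $p$ of length $|p|\ge1$ ending at $t(p)$ has weight $$w_{\mathcal T}(p)=\frac{w_{\lceil |p|/2\rceil}}{\|w\|_1}\cdot\frac1{\deg_G(t(p))}\prod_{q}\frac1{\deg_{\mathcal T}(q)-1},$$ the product being over the prefixes $q$ of $p$ with $1\le|q|<|p|$; the zero-length path has weight $0$. Put $\pi_{\mathcal T}(v)=\sum_{p\in\mathcal T,\,t(p)=v}w_{\mathcal T}(p)$. Let $\mathcal B_d^{(w)}$ be the set of the vectors $\frac1c\pi_{\mathcal T}$, for all $d$-trees $\mathcal T$ of height $2h$ with any root $r\in\mathcal V$, where $c\ge1$ is a constant (say, the least) such that $\mathcal B_d^{(w)}\subseteq[0,1]^N$. A codeword $x$ is *$(h,w,d)$-locally optimal* with respect to $\lambda\in\mathbb R^N$ if $\langle\lambda,x\oplus\beta\rangle>\langle\lambda,x\rangle$ for all $\beta\in\mathcal B_d^{(w)}$, where $(x\oplus\beta)_i=|x_i-\beta_i|$. *Channel.* A memoryless binary-input output-symmetric channel has conditional densities $f(\cdot\mid0),f(\cdot\mid1)$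 on $\mathbb R$ with respect to a reference measure invariant under $y\mapsto-y$, with $f(y\mid0)=f(-y\mid1)$; the received symbols $y_i$ are independent given the transmitted word. The log-likelihood ratios $\lambda_i=\ln\frac{f(y_i\mid0)}{f(y_i\mid1)}$ are assumed to be almost surely finite. *Process.* Let $\mathcal T$ be the rooted tree of height $2h$ in which the root has $d_L$ children, every other node at even depth below $2h$ has $d_L-1$ children, and every node at odd depth has $d_R-1$ children (even depth: variable nodes; odd depth: local-code nodes). Assign to its variable nodes independent values distributed as $\lambda_i$ given $c_i=0$. For $\omega=(\omega_0,\dots,\omega_{h-1})$, let $\Pi_{\lambda,d,d_L,d_R}(h,\omega)$ be the probability that the minimum over all $d$-trees $\tau$ of $\mathcal T$ of $$\sum_{l=0}^{h-1}\ \sum_{v\in\tau\text{ at depth }2h-2l}\omega_l\lambda_v$$ is at most $0$. **Lemma.** Suppose that $G$ is $(d_L,d_R)$-regular (variable nodes have degree $d_L$, local-code nodes degree $d_R$), $2\le d\le d^*$, $w\in\mathbb R_{\ge0}^h\setminus\{0^h\}$, and $h<\frac14\mathrm{girth}(G)$. Assume that the all-zero codeword is transmitted, and let $\lambda\in\mathbb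 R^N$ be the vector of log-likelihood ratios received from the channel. Then $0^N$ is $(h,w,d)$-locally optimal with respect to $\lambda$ with probability at least $$1-N\cdot\Pi_{\lambda,d,d_L,d_R}(h,\omega),\qquad \omega_l=w_{h-l}\cdot d_L^{-1}\cdot(d_L-1)^{l-h+1}\cdot(d-1)^{l-h}\quad(0\le l<h),$$ and with at least the same probability $0^N$ is the unique optimal solution of the LP, i.e. the unique minimizer of $\langle\lambda,x\rangle$ over $x\in\mathcal P$. -/

import Mathlib

open MeasureTheory

namespace TannerLP

/-! ### Rooted trees whose nodes are lists -/

section Trees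

variable {α : Type*}

/-- The degree of the node `p` in the rooted tree with node set `T`: a node of `T` is a list, its
parent is obtained by deleting the last entry, and the root is the empty list. -/
noncomputable def treeDeg (T : Set (List α)) (p : List α) : ℕ :=
  {q : List α | q ∈ T ∧
    ((p <+: q ∧ q.length = p.length + 1) ∨ (q <+: p ∧ p.length = q.length + 1))}.ncard

/-- `τ` is (the node set of) a `d`-tree in the rooted tree `T`: a subtree that contains the root,
in which each node at odd depth (a local-code node) has degree `d`, and in which each node at
even depth (a variable node) has the same degree as in `T`. A subtree of `T` containing the root
is the same as a prefix-closed set of nodes containing the root. -/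
structure IsDTree (d : ℕ) (T τ : Set (List α)) : Prop where
  subset : τ ⊆ T
  root_mem : [] ∈ τ
  prefix_closed : ∀ q ∈ τ, ∀ p, p <+: q → p ∈ τ
  local_code : ∀ p ∈ τ, Odd p.length → treeDeg τ p = d
  variable_node : ∀ p ∈ τ, Even p.length → treeDeg τ p = treeDeg T p

/-- The path-prefix tree of height `k` of the graph `G` rooted at `r`. Its nodes are the
backtrackless paths `(r, u₁, …, uₘ)`, `m ≤ k`, in `G`; such a path is recorded as the list
`[u₁, …, uₘ]`, whose length is the number of edges of the path. -/
def pathPrefixTree (G : SimpleGraph α) (r : α) (k : ℕ) : Set (List α) :=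
  {p | p.length ≤ k ∧ (r :: p).IsChain G.Adj ∧
    ∀ a b c, [a, b, c] <:+: (r :: p) → s(a, b) ≠ s(b, c)}

/-- The target of the path `(r, u₁, …, uₘ)` recorded by `p = [u₁, …, uₘ]`. -/
def pathTarget (r : α) (p : List α) : α := p.getLastD r

/-- The degree of a vertex of a graph. -/
noncomputable def vertexDeg (G : SimpleGraph α) (u : α) : ℕ := (G.neighborSet u).ncard

/-- `w_ℓ` for a vector `w = (w_1, …, w_h)` (and `0` when `ℓ` is not in `{1, …, h}`). -/
def levelWeight {h : ℕ} (w : Fin h → ℝ) (ℓ : ℕ) : ℝ :=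
  if hℓ : ℓ - 1 < h ∧ 1 ≤ ℓ then w ⟨ℓ - 1, hℓ.1⟩ else 0

/-- The weight function `w_τ` of a `w`-weighted subtree `τ` of the path-prefix tree of `G` rooted
at `r`: zero for the zero-length path, and otherwise
`w_ℓ / ‖w‖₁ * 1 / deg_G (t(p)) * ∏ 1 / (deg_τ(q) - 1)` with `ℓ = ⌈|p| / 2⌉`, the product ranging
over the prefixes `q` of `p` with `1 ≤ |q| < |p|`. -/
noncomputable def subtreeWeight (G : SimpleGraph α) (r : α) {h : ℕ} (w : Fin h → ℝ)
    (τ : Set (List α)) (p : List α) : ℝ :=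
  if p = [] then 0 else
    levelWeight w ((p.length + 1) / 2) / (∑ i, |w i|)
      * (1 / (vertexDeg G (pathTarget r p) : ℝ))
      * ∏ k ∈ Finset.Ico 1 p.length, 1 / ((treeDeg τ (p.take k) : ℝ) - 1)

end Trees

/-! ### Tanner codes -/

/-- A Tanner graph with variable nodes `V` and local-code nodes `J`, together with its local codes.
The edges at the local-code node `j` are labelled by `Fin (len j)`, `nbr j` lists the neighbours
of `j` in the order of the labels, and `localCode j` is a binary linear code of length `len j`. -/
structure TannerCode (V J : Type*) where
  len : J → ℕ
  nbr : (j : J) → Fin (len j) ↪ V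
  localCode : (j : J) → Submodule (ZMod 2) (Fin (len j) → ZMod 2)

namespace TannerCode

variable {V J : Type*} (C : TannerCode V J)

/-- The underlying bipartite graph. -/
def graph : SimpleGraph (V ⊕ J) :=
  SimpleGraph.fromRel fun a b =>
    ∃ (v : V) (j : J), a = Sum.inl v ∧ b = Sum.inr j ∧ v ∈ Set.range (C.nbr j)

/-- The Tanner graph is `(dL, dR)`-regular. -/
def IsRegular (dL dR : ℕ) : Prop :=
  (∀ v : V, vertexDeg C.graph (Sum.inl v) = dL) ∧ ∀ j : J, vertexDeg C.graph (Sum.inr j) = dR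

/-- The words that satisfy the local code at `j`. -/
def extendedLocalCode (j : J) : Set (V → ZMod 2) := {x | (fun i => x (C.nbr j i)) ∈ C.localCode j}

/-- The Tanner code. -/
def code : Set (V → ZMod 2) := ⋂ j, C.extendedLocalCode j

/-- The minimum local distance `d* = min_j d_j`, where `d_j` is the least Hamming weight of a
nonzero codeword of the `j`-th local code (`⊤` if there is none). -/
noncomputable def minLocalDist : ℕ∞ :=
  ⨅ (j : J) (c : Fin (C.len j) → ZMod 2) (_ : c ∈ C.localCode j) (_ : c ≠ 0),
    ((hammingNorm c : ℕ) : ℕ∞)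

end TannerCode

/-- A binary word as a vector of real numbers `0` and `1`. -/
def realWord {V : Type*} (x : V → ZMod 2) : V → ℝ := fun v => ((x v).val : ℝ)

namespace TannerCode

variable {V J : Type*} (C : TannerCode V J)

/-- The generalized fundamental polytope. -/
def fundamentalPolytope : Set (V → ℝ) :=
  ⋂ j, convexHull ℝ (realWord '' C.extendedLocalCode j)

/-- The word `x` is the unique optimal solution of the linear program
`min ⟨lam, z⟩` subject to `z` in the generalized fundamental polytope. -/
def IsUniqueLPOptimum [Fintype V] (lam : V → ℝ) (x : V → ZMod 2) : Prop :=
  realWord x ∈ C.fundamentalPolytope ∧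
    ∀ z ∈ C.fundamentalPolytope, z ≠ realWord x → ∑ v, lam v * realWord x v < ∑ v, lam v * z v

/-- The set of `d`-trees of height `2 * h` of the Tanner graph rooted at the variable node `r`. -/
def dTrees (h d : ℕ) (r : V) : Set (Set (List (V ⊕ J))) :=
  {τ | IsDTree d (pathPrefixTree C.graph (Sum.inl r) (2 * h)) τ}

/-- The projection to the Tanner graph of the `w`-weighted subtree `τ` rooted at `r`. -/
noncomputable def projection {h : ℕ} (w : Fin h → ℝ) (r : V) (τ : Set (List (V ⊕ J))) (v : V) : ℝ :=
  ∑ᶠ p ∈ {p : List (V ⊕ J) | p ∈ τ ∧ pathTarget (Sum.inl r) p = Sum.inl v},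
    subtreeWeight C.graph (Sum.inl r) w τ p

/-- The least constant `c ≥ 1` such that dividing the projections of all `w`-weighted `d`-trees
by `c` yields vectors in `[0, 1]^V`. -/
noncomputable def normConst {h : ℕ} (w : Fin h → ℝ) (d : ℕ) : ℝ :=
  max 1 (sSup {t | ∃ r : V, ∃ τ ∈ C.dTrees h d r, ∃ v : V, t = C.projection w r τ v})

/-- The set of projected normalized weighted deviations. -/
def deviations {h : ℕ} (w : Fin h → ℝ) (d : ℕ) : Set (V → ℝ) :=
  {β | ∃ r : V, ∃ τ ∈ C.dTrees h d r, β = fun v => (1 / C.normConst w d) * C.projection w r τ v}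

/-- The word `x` is an `(h, w, d)`-locally optimal codeword with respect to `lam`: it is a codeword
and `⟨lam, x ⊕ β⟩ > ⟨lam, x⟩` for every deviation `β`, where `(x ⊕ β)_v = |x_v - β_v|`. -/
def IsLocallyOptimal [Fintype V] {h : ℕ} (w : Fin h → ℝ) (d : ℕ) (lam : V → ℝ)
    (x : V → ZMod 2) : Prop :=
  x ∈ C.code ∧ ∀ β ∈ C.deviations w d,
    ∑ v, lam v * realWord x v < ∑ v, lam v * |realWord x v - β v|

end TannerCode

/-! ### Memoryless binary-input output-symmetric channels -/

/-- A memoryless binary-input output-symmetric channel. The conditional law of the received symbol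
given the input `a` has density `f a` with respect to a reference measure `ref` on `ℝ` that is
invariant under `y ↦ -y` (Lebesgue measure for a continuous channel, a counting measure for a
discrete one), and `f 0 y = f 1 (-y)`. The condition `llr_finite` says that the log-likelihood
ratio is almost surely a real number. -/
structure MBIOSChannel where
  ref : Measure ℝ
  ref_symm : ref.map (fun y => -y) = ref
  f : ZMod 2 → ℝ → ℝ
  f_measurable : ∀ a, Measurable (f a)
  f_nonneg : ∀ a y, 0 ≤ f a y
  lintegral_f : ∀ a, ∫⁻ y, ENNReal.ofReal (f a y) ∂ref = 1
  f_symm : ∀ y, f 0 y = f 1 (-y)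
  llr_finite : ∀ᵐ y ∂ref, f 0 y = 0 ↔ f 1 y = 0

namespace MBIOSChannel

variable (ch : MBIOSChannel)

/-- The conditional law of a received symbol given the transmitted symbol `a`. -/
noncomputable def symbolLaw (a : ZMod 2) : Measure ℝ :=
  ch.ref.withDensity fun y => ENNReal.ofReal (ch.f a y)

/-- The conditional law of the received word given the transmitted word `c`. -/
noncomputable def wordLaw {V : Type*} [Fintype V] (c : V → ZMod 2) : Measure (V → ℝ) :=
  Measure.pi fun v => ch.symbolLaw (c v)

/-- The log-likelihood ratio of a received symbol. -/
noncomputable def llr (y : ℝ) : ℝ := Real.log (ch.f 0 y / ch.f 1 y)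

/-- The law of the log-likelihood ratio of a symbol when `0` is transmitted. -/
noncomputable def llrLaw : Measure ℝ := (ch.symbolLaw 0).map ch.llr

instance isProbabilityMeasure_symbolLaw (a : ZMod 2) : IsProbabilityMeasure (ch.symbolLaw a) :=
  ⟨by simp [symbolLaw, ch.lintegral_f a]⟩

theorem measurable_llr : Measurable ch.llr :=
  Real.measurable_log.comp ((ch.f_measurable 0).div (ch.f_measurable 1))

instance isProbabilityMeasure_llrLaw : IsProbabilityMeasure ch.llrLaw :=
  Measure.isProbabilityMeasure_map ch.measurable_llr.aemeasurable

end MBIOSChannel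

/-! ### The process on a regular tree -/

/-- The `(dL, dR)`-regular tree of height `k`, rooted at a variable node: the root has `dL`
children, each other variable node (even depth) above depth `k` has `dL - 1` children, and each
local-code node (odd depth) above depth `k` has `dR - 1` children. The children of a node are
numbered, and a node is the list of the numbers met on the way from the root. -/
def regularTree (dL dR k : ℕ) : Set (List ℕ) :=
  {p | p.length ≤ k ∧ ∀ i (hi : i < p.length),
    p[i] < if i = 0 then dL else if Odd i then dR - 1 else dL - 1}

/-- The `ω`-weighted value `∑_{l < h} ∑_{p ∈ τ ∩ V_{2l}} ω_l * lam_p` of a subtree `τ` of a tree of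
height `2 * h`, where `V_{2l}` is the set of nodes at height `2 * l` (depth `2 * h - 2 * l`). -/
noncomputable def treeValue {α : Type*} {h : ℕ} (ω : Fin h → ℝ) (τ : Set (List α))
    (lam : List α → ℝ) : ℝ :=
  ∑ l : Fin h, ∑ᶠ p ∈ {p : List α | p ∈ τ ∧ p.length + 2 * (l : ℕ) = 2 * h}, ω l * lam p

/-- `Π_{λ,d,dL,dR}(h, ω)`: the probability that the minimum `ω`-weighted value over all `d`-trees in
the `(dL, dR)`-regular tree of height `2 * h` is nonpositive, when independent random values of law
`γ` are assigned to the nodes. -/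
noncomputable def processProb (γ : Measure ℝ) (d dL dR h : ℕ) (ω : Fin h → ℝ) : ℝ :=
  (Measure.infinitePi fun _ : List ℕ => γ).real
    {lam | ∃ τ, IsDTree d (regularTree dL dR (2 * h)) τ ∧ treeValue ω τ lam ≤ 0}

/-- The process weights
`ω_l = w_{h-l} * dL⁻¹ * (dL - 1)^(l-h+1) * (d - 1)^(l-h)` for `0 ≤ l < h`. -/
noncomputable def processWeight (d dL : ℕ) {h : ℕ} (w : Fin h → ℝ) (l : Fin h) : ℝ :=
  levelWeight w (h - l) * (dL : ℝ)⁻¹ * ((dL : ℝ) - 1) ^ ((l : ℤ) - (h : ℤ) + 1)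
    * ((d : ℝ) - 1) ^ ((l : ℤ) - (h : ℤ))

end TannerLP

/-! Deviations are nonnegative, so local optimality of the zero word means ⟨λ, β⟩ > 0 for every
deviation β. In a regular graph the weight of a variable path of positive length depends only on its
depth 2h - 2l and equals ω_l / ‖w‖₁ (`subtreeWeight_eq`). The condition becomes: every d-tree of
every path-prefix tree has positive ω-value (`isLocallyOptimal_zero_iff`).

Probability. The path-prefix tree at a root r is isomorphic to the regular tree
(`exists_treeIso_regularTree`), and d-trees and their values pull back along the isomorphism.
Because the girth exceeds 4h, different nodes of the tree end at different vertices
(`injOn_pathTarget`). Hence the values at the variable nodes are independent with the law of the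
process, and some d-tree at r has nonpositive value with probability at most Π
(`measureReal_exists_dTree_le`). A union bound over the N roots gives the first claim.

Linear program. That positive trees force a unique optimum is deterministic and independent of the
girth (`isUniqueLPOptimum_zero`). Dynamic programming yields A_k(j, v), the least value, suitably
scaled, of k levels of variable nodes below j when j is entered from v. Each A_{k+1}(j, v) is the
mean of node values over a cheapest (d-1)-set of neighbours of j other than v. A local codeword with
v in its support has at least d-1 further support points there, so A_{k+1}(j, v) is at most the mean
of the node values over them. Summing over the support and passing to the convex hull gives an
inequality for each x in the polytope (`sum_mul_le_of_mem_convexHull`). Summing it over j and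
iterating over k bounds ∑ x_v A_h(j, v) by s⟨λ, x⟩ with s ≥ 0. The left side is positive for x ≠ 0,
because ∑_j A_h(j, r) is a positive multiple of the value of a d-tree rooted at r
(`IsMinimizer.treeValue_selectedTree`). -/

namespace TannerLP

/-! ### Prefix-closed trees: children, degrees, levels. -/

section Trees

variable {α : Type*}

/-- The labels of the children of the node `p` in the tree `T`. -/
def children (T : Set (List α)) (p : List α) : Set α := {a | p ++ [a] ∈ T}

/-- The nodes of `T` at depth `n`. -/
def level (T : Set (List α)) (n : ℕ) : Set (List α) := {p | p ∈ T ∧ p.length = n}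

/-- A set of nodes closed under taking parents. -/
def PrefixClosed (T : Set (List α)) : Prop := ∀ q ∈ T, ∀ p, p <+: q → p ∈ T

theorem mem_children {T : Set (List α)} {p : List α} {a : α} :
    a ∈ children T p ↔ p ++ [a] ∈ T := Iff.rfl

theorem PrefixClosed.of_concat {T : Set (List α)} (hT : PrefixClosed T) {p : List α} {a : α}
    (h : p ++ [a] ∈ T) : p ∈ T := hT _ h _ (List.prefix_append _ _)

/-- The correction term counts the parent, which every node but the root has. Finiteness matters
because `Set.ncard` is 0 on infinite sets. -/
theorem treeDeg_eq_ncard_children {T : Set (List α)} (hT : PrefixClosed T) {p : List α}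
    (hp : p ∈ T) (hfin : (children T p).Finite) :
    treeDeg T p = (children T p).ncard + if p = [] then 0 else 1 := by
  have hset : {q : List α | q ∈ T ∧
      ((p <+: q ∧ q.length = p.length + 1) ∨ (q <+: p ∧ p.length = q.length + 1))} =
      (fun a => p ++ [a]) '' children T p ∪ (if p = [] then ∅ else {p.dropLast}) := by
    ext q
    simp only [Set.mem_ofPred_eq, Set.mem_union, Set.mem_image, mem_children]
    constructor
    · rintro ⟨hq, ⟨⟨t, rfl⟩, hl⟩ | ⟨⟨t, ht⟩, hl⟩⟩
      · simp only [List.length_append, Nat.add_left_cancel_iff] at hl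
        obtain ⟨a, rfl⟩ := List.length_eq_one_iff.1 hl
        exact Or.inl ⟨a, hq, rfl⟩
      · right
        subst ht
        simp only [List.length_append, Nat.add_left_cancel_iff] at hl
        obtain ⟨a, rfl⟩ := List.length_eq_one_iff.1 hl
        simp
    · rintro (⟨a, ha, rfl⟩ | h)
      · exact ⟨ha, Or.inl ⟨List.prefix_append _ _, by simp⟩⟩
      · split_ifs at h with h0
        · exact h.elim
        · rw [Set.mem_singleton_iff] at h
          subst h
          refine ⟨hT _ hp _ (List.dropLast_prefix p), Or.inr ⟨List.dropLast_prefix p, ?_⟩⟩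
          have := List.length_pos_iff.2 h0
          simp; omega
  have hinj : Function.Injective (fun a : α => p ++ [a]) := fun a b hab => by simpa using hab
  rw [treeDeg, hset, Set.ncard_union_eq _ (hfin.image _) (by split_ifs <;> simp),
    Set.ncard_image_of_injective _ hinj]
  · split_ifs <;> simp
  · rw [Set.disjoint_left]
    rintro _ ⟨a, -, rfl⟩ h
    split_ifs at h with h0
    · exact h
    · have := congrArg List.length (Set.mem_singleton_iff.1 h)
      simp at this
      omega

theorem level_succ {T : Set (List α)} (hT : PrefixClosed T) (n : ℕ) :
    level T (n + 1) = ⋃ p ∈ level T n, (fun a => p ++ [a]) '' children T p := by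
  ext q
  simp only [level, Set.mem_ofPred_eq, Set.mem_iUnion, Set.mem_image, mem_children, exists_prop]
  constructor
  · rintro ⟨hq, hl⟩
    obtain rfl | ⟨p, a, rfl⟩ := q.eq_nil_or_concat
    · simp at hl
    · simp only [List.concat_eq_append] at hq hl ⊢
      exact ⟨p, ⟨hT.of_concat hq, by simpa using hl⟩, a, hq, rfl⟩
  · rintro ⟨p, ⟨-, hl⟩, a, ha, rfl⟩
    exact ⟨ha, by simp [hl]⟩

theorem level_finite {T : Set (List α)} (hT : T.Finite) (n : ℕ) : (level T n).Finite :=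
  hT.subset fun _ hp => hp.1

theorem children_finite {T : Set (List α)} (hT : T.Finite) (p : List α) :
    (children T p).Finite :=
  hT.preimage (f := fun a => p ++ [a]) fun a _ b _ hab => by simpa using hab

theorem finsum_level_succ {T : Set (List α)} (hT : PrefixClosed T) (hfin : T.Finite)
    (f : List α → ℝ) (n : ℕ) :
    ∑ᶠ p ∈ level T (n + 1), f p = ∑ᶠ p ∈ level T n, ∑ᶠ a ∈ children T p, f (p ++ [a]) := by
  rw [level_succ hT, finsum_mem_biUnion _ (level_finite hfin n)
    fun p _ => (children_finite hfin p).image _]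
  · refine finsum_mem_congr rfl fun p _ => ?_
    rw [finsum_mem_image]
    exact fun a _ b _ hab => by simpa using hab
  · intro p _ q _ hpq
    simp only [Function.onFun, Set.disjoint_left]
    rintro _ ⟨a, -, rfl⟩ ⟨b, -, hb⟩
    exact hpq (by simpa using (List.append_inj' hb rfl).1.symm)

theorem treeValue_eq_sum_level {h : ℕ} (ω : Fin h → ℝ) (τ : Set (List α)) (lam : List α → ℝ) :
    treeValue ω τ lam =
      ∑ l : Fin h, ∑ᶠ p ∈ level τ (2 * h - 2 * (l : ℕ)), ω l * lam p := by
  refine Finset.sum_congr rfl fun l _ => finsum_mem_congr ?_ fun _ _ => rfl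
  ext p
  have := l.2
  simp only [level, Set.mem_ofPred_eq]
  refine and_congr_right fun _ => ?_
  omega

theorem IsDTree.prefixClosed {d : ℕ} {T τ : Set (List α)} (hτ : IsDTree d T τ) :
    PrefixClosed τ := hτ.prefix_closed

/-! ### Isomorphisms of rooted trees and transport of d-trees. -/

section Iso

/-- A length-preserving isomorphism of the rooted trees `T` and `T'`. -/
structure TreeIso {β : Type*} (T : Set (List β)) (T' : Set (List α)) (φ : List β → List α) :
    Prop where
  map_nil : φ [] = []
  length_map : ∀ p, (φ p).length = p.length
  bijOn : Set.BijOn φ T T'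
  map_concat : ∀ p ∈ T, ∃ e : β → α, Set.BijOn e (children T p) (children T' (φ p)) ∧
    ∀ i, φ (p ++ [i]) = φ p ++ [e i]

/-- Trees whose branching depends only on the depth, through the same function, are isomorphic:
number the children of each node of the target and follow these numberings from the root. -/
theorem exists_treeIso [Nonempty α] {T : Set (List ℕ)} {T' : Set (List α)} (b : ℕ → ℕ)
    (hT : PrefixClosed T) (hT' : PrefixClosed T') (h0 : [] ∈ T) (h0' : [] ∈ T')
    (hfin : T'.Finite) (hb : ∀ p ∈ T, children T p = Set.Iio (b p.length))
    (hb' : ∀ p ∈ T', (children T' p).ncard = b p.length) : ∃ φ, TreeIso T T' φ := by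
  have hex : ∀ q, ∃ e : ℕ → α, q ∈ T' → Set.BijOn e (Set.Iio (b q.length)) (children T' q) := by
    intro q
    by_cases hq : q ∈ T'
    · obtain ⟨e, he⟩ := (Set.finite_Iio (b q.length)).exists_bijOn_of_encard_eq
        (t := children T' q) (by
          rw [← (children_finite hfin q).cast_ncard_eq, hb' q hq,
            ← (Set.finite_Iio _).cast_ncard_eq]
          simp)
      exact ⟨e, fun _ => he⟩
    · exact ⟨fun _ => Classical.arbitrary α, fun h => absurd h hq⟩
  choose e he using hex
  let φ : List ℕ → List α := fun p => p.foldl (fun q i => q ++ [e q i]) []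
  have hφ : ∀ p i, φ (p ++ [i]) = φ p ++ [e (φ p) i] := fun p i => by
    simp only [φ, List.foldl_append, List.foldl_cons, List.foldl_nil]
  have hlen : ∀ p, (φ p).length = p.length := by
    intro p
    induction p using List.reverseRecOn with
    | nil => rfl
    | append_singleton p i ih => simp [hφ, ih]
  have hmap : ∀ p ∈ T, φ p ∈ T' := by
    intro p
    induction p using List.reverseRecOn with
    | nil => exact fun _ => h0'
    | append_singleton p i ih =>
      intro hp
      have hpT := hT.of_concat hp
      rw [hφ]
      refine (he _ (ih hpT)).mapsTo ?_
      rw [hlen, ← hb p hpT]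
      exact hp
  have hinj : ∀ p ∈ T, ∀ q ∈ T, φ p = φ q → p = q := by
    intro p
    induction p using List.reverseRecOn with
    | nil =>
      intro _ q _ hq
      have := congrArg List.length hq
      rw [hlen, hlen] at this
      exact (List.length_eq_zero_iff.1 this.symm).symm
    | append_singleton p i ih =>
      intro hp q hq hpq
      obtain rfl | ⟨q, j, rfl⟩ := q.eq_nil_or_concat
      · have := congrArg List.length hpq
        simp [hlen] at this
      · simp only [List.concat_eq_append] at hq hpq ⊢
        rw [hφ, hφ] at hpq
        obtain ⟨h1, h2⟩ := List.append_inj' hpq rfl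
        have hpT := hT.of_concat hp
        obtain rfl := ih hpT q (hT.of_concat hq) h1
        have hij := (he _ (hmap _ hpT)).injOn (x₁ := i) (x₂ := j)
          (by rw [hlen, ← hb p hpT]; exact hp) (by rw [hlen, ← hb p hpT]; exact hq)
          (by simpa using h2)
        rw [hij]
  have hsurj : ∀ q ∈ T', ∃ p ∈ T, φ p = q := by
    intro q
    induction q using List.reverseRecOn with
    | nil => exact fun _ => ⟨[], h0, rfl⟩
    | append_singleton q a ih =>
      intro hq
      obtain ⟨p, hp, rfl⟩ := ih (hT'.of_concat hq)
      obtain ⟨i, hi, rfl⟩ := (he _ (hmap _ hp)).surjOn hq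
      rw [hlen, ← hb p hp] at hi
      exact ⟨p ++ [i], hi, hφ p i⟩
  refine ⟨φ, rfl, hlen, ⟨hmap, fun p hp q hq => hinj p hp q hq, hsurj⟩, fun p hp => ?_⟩
  refine ⟨e (φ p), ?_, hφ p⟩
  have := he _ (hmap _ hp)
  rwa [hlen, ← hb p hp] at this

variable {β : Type*} {T : Set (List β)} {T' : Set (List α)} {φ : List β → List α}

theorem TreeIso.bijOn_subtree (hφ : TreeIso T T' φ) {τ : Set (List α)} (hτ : τ ⊆ T') :
    Set.BijOn φ (T ∩ φ ⁻¹' τ) τ :=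
  ⟨fun _ hp => hp.2, hφ.bijOn.injOn.mono Set.inter_subset_left, fun q hq => by
    obtain ⟨p, hp, rfl⟩ := hφ.bijOn.surjOn (hτ hq)
    exact ⟨p, ⟨hp, hq⟩, rfl⟩⟩

theorem TreeIso.map_prefix (hφ : TreeIso T T' φ) (hT : PrefixClosed T) {p q : List β}
    (hq : q ∈ T) (hpq : p <+: q) : φ p <+: φ q := by
  induction q using List.reverseRecOn with
  | nil => rw [List.prefix_nil.1 hpq]
  | append_singleton q i ih =>
    obtain rfl | h := List.prefix_concat_iff.1 hpq
    · exact List.prefix_rfl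
    · obtain ⟨e, -, he⟩ := hφ.map_concat q (hT.of_concat hq)
      rw [he]
      exact (ih (hT.of_concat hq) h).trans (List.prefix_append _ _)

theorem TreeIso.prefixClosed_subtree (hφ : TreeIso T T' φ) (hT : PrefixClosed T)
    {τ : Set (List α)} (hτ : PrefixClosed τ) : PrefixClosed (T ∩ φ ⁻¹' τ) :=
  fun q hq _ hpq => ⟨hT q hq.1 _ hpq, hτ _ hq.2 _ (hφ.map_prefix hT hq.1 hpq)⟩

theorem TreeIso.treeDeg_subtree (hφ : TreeIso T T' φ) (hT : PrefixClosed T) (hfin : T.Finite)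
    (hfin' : T'.Finite) {τ : Set (List α)} (hτ : PrefixClosed τ) (hsub : τ ⊆ T') {p : List β}
    (hp : p ∈ T) (hpτ : φ p ∈ τ) : treeDeg (T ∩ φ ⁻¹' τ) p = treeDeg τ (φ p) := by
  obtain ⟨e, he, hcat⟩ := hφ.map_concat p hp
  have hnil : φ p = [] ↔ p = [] := by
    rw [← List.length_eq_zero_iff, hφ.length_map, List.length_eq_zero_iff]
  rw [treeDeg_eq_ncard_children (hφ.prefixClosed_subtree hT hτ) ⟨hp, hpτ⟩
      (children_finite (hfin.subset Set.inter_subset_left) p),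
    treeDeg_eq_ncard_children hτ hpτ (children_finite (hfin'.subset hsub) _)]
  simp only [hnil]
  congr 1
  have himg : children τ (φ p) = e '' children (T ∩ φ ⁻¹' τ) p := by
    ext a
    constructor
    · intro ha
      obtain ⟨i, hi, rfl⟩ := he.surjOn (hsub ha)
      exact ⟨i, ⟨hi, by rw [Set.mem_preimage, hcat]; exact ha⟩, rfl⟩
    · rintro ⟨i, hi, rfl⟩
      rw [mem_children, ← hcat]
      exact hi.2
  rw [himg, (he.injOn.mono fun i hi => hi.1).ncard_image]

theorem TreeIso.isDTree_subtree (hφ : TreeIso T T' φ) (hT : PrefixClosed T)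
    (hT' : PrefixClosed T') (h0 : [] ∈ T) (hfin : T.Finite) (hfin' : T'.Finite) {d : ℕ}
    {τ : Set (List α)} (hτ : IsDTree d T' τ) : IsDTree d T (T ∩ φ ⁻¹' τ) where
  subset := Set.inter_subset_left
  root_mem := ⟨h0, by rw [Set.mem_preimage, hφ.map_nil]; exact hτ.root_mem⟩
  prefix_closed := hφ.prefixClosed_subtree hT hτ.prefixClosed
  local_code p hp hodd := by
    rw [hφ.treeDeg_subtree hT hfin hfin' hτ.prefixClosed hτ.subset hp.1 hp.2]
    exact hτ.local_code _ hp.2 (by rwa [hφ.length_map])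
  variable_node p hp heven := by
    -- The degree in the whole tree is the case τ = T' of `treeDeg_subtree`.
    have hinter : T ∩ φ ⁻¹' T' = T := Set.inter_eq_left.2 fun q hq => hφ.bijOn.mapsTo hq
    rw [hφ.treeDeg_subtree hT hfin hfin' hτ.prefixClosed hτ.subset hp.1 hp.2,
      hτ.variable_node _ hp.2 (by rwa [hφ.length_map]),
      ← hφ.treeDeg_subtree hT hfin hfin' hT' subset_rfl hp.1 (hφ.bijOn.mapsTo hp.1),
      hinter]

theorem TreeIso.treeValue_subtree (hφ : TreeIso T T' φ) {τ : Set (List α)} (hsub : τ ⊆ T')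
    {h : ℕ} (ω : Fin h → ℝ) (lam : List α → ℝ) :
    treeValue ω (T ∩ φ ⁻¹' τ) (lam ∘ φ) = treeValue ω τ lam := by
  rw [treeValue_eq_sum_level, treeValue_eq_sum_level]
  refine Finset.sum_congr rfl fun l _ => ?_
  have hb := hφ.bijOn_subtree hsub
  refine finsum_mem_eq_of_bijOn φ ⟨fun p hp => ⟨hp.1.2, (hφ.length_map p).trans hp.2⟩,
    hb.injOn.mono fun p hp => hp.1, fun q hq => ?_⟩ fun p _ => rfl
  obtain ⟨p, hp, rfl⟩ := hb.surjOn hq.1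
  exact ⟨p, ⟨hp, (hφ.length_map p).symm.trans hq.2⟩, rfl⟩

end Iso

end Trees

section Trees

variable {α : Type*}

theorem pathTarget_nil (r : α) : pathTarget r [] = r := rfl

theorem pathTarget_concat (r : α) (p : List α) (a : α) : pathTarget r (p ++ [a]) = a := by
  simp [pathTarget]

/-! ### Path-prefix trees of a graph. -/

section PathPrefixTree

variable (G : SimpleGraph α) (r : α) (k : ℕ)

theorem prefixClosed_pathPrefixTree : PrefixClosed (pathPrefixTree G r k) := by
  rintro _ ⟨h1, h2, h3⟩ p ⟨t, rfl⟩
  refine ⟨?_, ?_, ?_⟩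
  · simp at h1; omega
  · rw [← List.cons_append] at h2
    exact h2.left_of_append
  · intro a b c habc
    refine h3 a b c (habc.trans ?_)
    rw [← List.cons_append]
    exact (List.prefix_append _ _).isInfix

theorem pathPrefixTree_finite [Finite α] : (pathPrefixTree G r k).Finite :=
  (List.finite_length_le α k).subset fun _ hp => hp.1

theorem nil_mem_pathPrefixTree : [] ∈ pathPrefixTree G r k := by
  refine ⟨by simp, by simp, fun a b c h => ?_⟩
  have := h.length_le
  simp at this

variable {G r k}

theorem singleton_mem_pathPrefixTree {a : α} :
    [a] ∈ pathPrefixTree G r k ↔ 0 < k ∧ G.Adj r a := by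
  constructor
  · rintro ⟨h1, h2, -⟩
    exact ⟨by simpa [Nat.succ_le_iff] using h1, by simpa using h2⟩
  · rintro ⟨h1, h2⟩
    refine ⟨by simpa [Nat.succ_le_iff] using h1, by simpa using h2, fun a b c h => ?_⟩
    have := h.length_le
    simp at this

/-- Appending a vertex creates one new edge and one new consecutive triple, so backtracking has to
be excluded only at the last triple. -/
theorem concat_concat_mem_pathPrefixTree {q : List α} {b a : α} :
    q ++ [b] ++ [a] ∈ pathPrefixTree G r k ↔
      q ++ [b] ∈ pathPrefixTree G r k ∧ q.length + 1 < k ∧ G.Adj b a ∧ a ≠ pathTarget r q := by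
  have hq : ∃ s, r :: q = s ++ [pathTarget r q] := by
    obtain rfl | ⟨q, x, rfl⟩ := q.eq_nil_or_concat
    · exact ⟨[], rfl⟩
    · exact ⟨r :: q, by simp [pathTarget]⟩
  obtain ⟨s, hs⟩ := hq
  have hlist : r :: (q ++ [b] ++ [a]) = s ++ [pathTarget r q, b, a] := by
    rw [List.append_assoc, ← List.cons_append, hs]; simp
  have hlist' : r :: (q ++ [b]) = s ++ [pathTarget r q, b] := by
    rw [← List.cons_append, hs]; simp
  have hcat : r :: (q ++ [b] ++ [a]) = (r :: (q ++ [b])) ++ [a] := by simp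
  constructor
  · intro h
    refine ⟨(prefixClosed_pathPrefixTree G r k).of_concat h, ?_, ?_, ?_⟩
    · have := h.1; simp at this; omega
    · have := h.2.1
      rw [hlist] at this
      have := this.right_of_append
      simp at this
      exact this.2
    · rintro rfl
      refine h.2.2 (pathTarget r q) b (pathTarget r q) ?_ Sym2.eq_swap
      rw [hlist]
      exact (List.suffix_append _ _).isInfix
  · rintro ⟨h, hk, hadj, hne⟩
    refine ⟨by simp; omega, ?_, ?_⟩
    · rw [hcat, List.isChain_append]
      refine ⟨h.2.1, by simp, ?_⟩
      intro x hx y hy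
      rw [hlist'] at hx
      simp at hx hy
      subst hx hy
      exact hadj
    · intro x y z hxyz
      rw [hcat, List.infix_concat_iff] at hxyz
      obtain hxyz | hxyz := hxyz
      · rw [← hcat, hlist] at hxyz
        have := (List.suffix_iff_eq_drop.1 hxyz)
        have h3 : [x, y, z] = [pathTarget r q, b, a] := by
          rw [this]
          simp
        simp only [List.cons.injEq, and_true] at h3
        obtain ⟨rfl, rfl, rfl⟩ := h3
        intro h
        rw [Sym2.eq_iff] at h
        obtain ⟨h, h'⟩ | ⟨h, -⟩ := h
        · exact hne (h'.symm.trans h.symm)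
        · exact hne h.symm
      · exact h.2.2 x y z hxyz

theorem children_nil_pathPrefixTree (hk : 0 < k) :
    children (pathPrefixTree G r k) [] = G.neighborSet r := by
  ext a
  rw [mem_children, List.nil_append, singleton_mem_pathPrefixTree]
  simp [hk]

theorem children_concat_pathPrefixTree {q : List α} {b : α}
    (hq : q ++ [b] ∈ pathPrefixTree G r k) (hk : q.length + 1 < k) :
    children (pathPrefixTree G r k) (q ++ [b]) = G.neighborSet b \ {pathTarget r q} := by
  ext a
  rw [mem_children, concat_concat_mem_pathPrefixTree]
  simp [hq, hk]

theorem children_eq_empty_pathPrefixTree {p : List α} (hk : k ≤ p.length) :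
    children (pathPrefixTree G r k) p = ∅ := by
  ext a
  simp only [mem_children, Set.mem_empty_iff_false, iff_false]
  intro h
  have := h.1
  simp at this
  omega

theorem adj_of_concat_mem {p : List α} {a : α} (h : p ++ [a] ∈ pathPrefixTree G r k) :
    G.Adj (pathTarget r p) a := by
  obtain rfl | ⟨q, b, rfl⟩ := p.eq_nil_or_concat
  · exact (singleton_mem_pathPrefixTree.1 h).2
  · rw [List.concat_eq_append] at h ⊢
    rw [pathTarget_concat]
    exact (concat_concat_mem_pathPrefixTree.1 h).2.2.1

/-- The number of children of a node of the path-prefix tree of height `k`, in terms of its depth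
and of the degree `D` of the vertex at its end. -/
theorem ncard_children_pathPrefixTree [Finite α] {p : List α}
    (hp : p ∈ pathPrefixTree G r k) (hk : p.length < k) :
    (children (pathPrefixTree G r k) p).ncard =
      vertexDeg G (pathTarget r p) - if p = [] then 0 else 1 := by
  obtain rfl | ⟨q, b, rfl⟩ := p.eq_nil_or_concat
  · rw [children_nil_pathPrefixTree hk]
    simp [vertexDeg, pathTarget_nil]
  · simp only [List.concat_eq_append] at hp hk ⊢
    have hadj := adj_of_concat_mem hp
    rw [children_concat_pathPrefixTree hp (by simpa using hk), Set.ncard_sdiff_singleton_of_mem]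
    · simp [vertexDeg, pathTarget_concat]
    · exact hadj.symm

end PathPrefixTree

/-! ### The regular tree. -/

section RegularTree

theorem prefixClosed_regularTree (dL dR k : ℕ) : PrefixClosed (regularTree dL dR k) := by
  rintro _ ⟨h1, h2⟩ p ⟨t, rfl⟩
  refine ⟨by simp at h1; omega, fun i hi => ?_⟩
  have := h2 i (by simp; omega)
  rwa [List.getElem_append_left hi] at this

theorem nil_mem_regularTree (dL dR k : ℕ) : [] ∈ regularTree dL dR k := ⟨by simp, by simp⟩

/-- The number of children of a node at depth `n` of the regular tree. -/
def branching (dL dR k n : ℕ) : ℕ :=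
  if n < k then (if n = 0 then dL else if Odd n then dR - 1 else dL - 1) else 0

theorem children_regularTree {dL dR k : ℕ} {p : List ℕ} (hp : p ∈ regularTree dL dR k) :
    children (regularTree dL dR k) p = Set.Iio (branching dL dR k p.length) := by
  ext a
  rw [mem_children, Set.mem_Iio, branching]
  constructor
  · rintro ⟨h1, h2⟩
    have h := h2 p.length (by simp)
    rw [if_pos (by simpa using h1)]
    simpa using h
  · intro ha
    split_ifs at ha with hk <;> try omega
    all_goals
      refine ⟨by simpa using hk, fun i hi => ?_⟩
      simp only [List.length_append, List.length_singleton] at hi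
      obtain hi | rfl := Nat.lt_succ_iff_lt_or_eq.1 hi
      · rw [List.getElem_append_left hi]
        exact hp.2 i hi
      · simp [*]

theorem regularTree_finite (dL dR k : ℕ) : (regularTree dL dR k).Finite := by
  refine Set.Finite.subset
    (((List.finite_length_le (Fin (dL + dR)) k)).image (List.map Fin.val)) fun p hp => ?_
  have hmem : ∀ a ∈ p, a < dL + dR := by
    intro a ha
    obtain ⟨i, hi, rfl⟩ := List.getElem_of_mem ha
    have := hp.2 i hi
    split_ifs at this <;> omega
  lift p to List (Fin (dL + dR)) using hmem
  exact ⟨p, by simpa using hp.1, rfl⟩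

end RegularTree

end Trees

/-! ### The Tanner graph and its path-prefix trees. -/

namespace TannerCode

variable {V J : Type*} (C : TannerCode V J)

/-- The neighbours of the local-code node `j`. -/
def nbrSet (j : J) : Set V := Set.range (C.nbr j)

theorem adj_inl_inr {v : V} {j : J} :
    C.graph.Adj (Sum.inl v) (Sum.inr j) ↔ v ∈ C.nbrSet j := by
  simp [graph, SimpleGraph.fromRel_adj, nbrSet, eq_comm]

theorem adj_inr_inl {v : V} {j : J} :
    C.graph.Adj (Sum.inr j) (Sum.inl v) ↔ v ∈ C.nbrSet j := by
  rw [SimpleGraph.adj_comm, adj_inl_inr]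

theorem not_adj_inl_inl {v u : V} : ¬ C.graph.Adj (Sum.inl v) (Sum.inl u) := by
  simp [graph, SimpleGraph.fromRel_adj]

theorem not_adj_inr_inr {i j : J} : ¬ C.graph.Adj (Sum.inr i) (Sum.inr j) := by
  simp [graph, SimpleGraph.fromRel_adj]

theorem neighborSet_inl (v : V) :
    C.graph.neighborSet (Sum.inl v) = Sum.inr '' {j | v ∈ C.nbrSet j} := by
  ext (u | j)
  · simp [C.not_adj_inl_inl]
  · simp [C.adj_inl_inr]

theorem neighborSet_inr (j : J) : C.graph.neighborSet (Sum.inr j) = Sum.inl '' C.nbrSet j := by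
  ext (u | j)
  · simp [C.adj_inr_inl]
  · simp [C.not_adj_inr_inr]

theorem vertexDeg_inl (v : V) : vertexDeg C.graph (Sum.inl v) = {j | v ∈ C.nbrSet j}.ncard := by
  rw [vertexDeg, neighborSet_inl, Set.ncard_image_of_injective _ Sum.inr_injective]

theorem vertexDeg_inr (j : J) : vertexDeg C.graph (Sum.inr j) = (C.nbrSet j).ncard := by
  rw [vertexDeg, neighborSet_inr, Set.ncard_image_of_injective _ Sum.inl_injective]

variable {C}

/-- The end of an even path is a variable node, the end of an odd path is a local-code node. -/
theorem isLeft_pathTarget {r : V} {k : ℕ} {p : List (V ⊕ J)}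
    (hp : p ∈ pathPrefixTree C.graph (Sum.inl r) k) :
    (pathTarget (Sum.inl r) p).isLeft = true ↔ Even p.length := by
  induction p using List.reverseRecOn with
  | nil => simp [pathTarget_nil]
  | append_singleton p a ih =>
    have ih := ih ((prefixClosed_pathPrefixTree _ _ _).of_concat hp)
    have hadj := adj_of_concat_mem hp
    rw [pathTarget_concat, List.length_append, List.length_singleton, Nat.even_add_one, ← ih]
    generalize pathTarget (Sum.inl r) p = b at hadj
    rcases a with a | a <;> rcases b with b | b
    · exact absurd hadj C.not_adj_inl_inl
    · simp
    · simp
    · exact absurd hadj C.not_adj_inr_inr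

theorem exists_pathTarget_eq_inl {r : V} {k : ℕ} {p : List (V ⊕ J)}
    (hp : p ∈ pathPrefixTree C.graph (Sum.inl r) k) (h : Even p.length) :
    ∃ v, pathTarget (Sum.inl r) p = Sum.inl v := by
  have := (isLeft_pathTarget hp).2 h
  rwa [Sum.isLeft_iff] at this

theorem exists_pathTarget_eq_inr {r : V} {k : ℕ} {p : List (V ⊕ J)}
    (hp : p ∈ pathPrefixTree C.graph (Sum.inl r) k) (h : Odd p.length) :
    ∃ j, pathTarget (Sum.inl r) p = Sum.inr j := by
  have := (isLeft_pathTarget hp).not.2 (Nat.not_even_iff_odd.2 h)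
  rcases hx : pathTarget (Sum.inl r) p with v | j
  · simp [hx] at this
  · exact ⟨j, rfl⟩

theorem ncard_children_eq_branching [Finite V] [Finite J] {dL dR : ℕ} (hreg : C.IsRegular dL dR)
    {r : V} {k : ℕ} {p : List (V ⊕ J)} (hp : p ∈ pathPrefixTree C.graph (Sum.inl r) k) :
    (children (pathPrefixTree C.graph (Sum.inl r) k) p).ncard = branching dL dR k p.length := by
  rw [branching]
  split_ifs with hk h0 hodd
  · obtain rfl := List.length_eq_zero_iff.1 h0
    simpa [pathTarget_nil, hreg.1] using ncard_children_pathPrefixTree hp hk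
  · obtain ⟨j, hj⟩ := exists_pathTarget_eq_inr hp hodd
    rw [ncard_children_pathPrefixTree hp hk, hj, hreg.2, if_neg (by rintro rfl; simp at h0)]
  · obtain ⟨j, hj⟩ := exists_pathTarget_eq_inl hp (Nat.not_odd_iff_even.1 hodd)
    rw [ncard_children_pathPrefixTree hp hk, hj, hreg.1, if_neg (by rintro rfl; simp at h0)]
  · rw [children_eq_empty_pathPrefixTree (not_lt.1 hk), Set.ncard_empty]

theorem exists_treeIso_regularTree [Finite V] [Finite J] {dL dR : ℕ} (hreg : C.IsRegular dL dR)
    (r : V) (k : ℕ) :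
    ∃ φ, TreeIso (regularTree dL dR k) (pathPrefixTree C.graph (Sum.inl r) k) φ :=
  have : Nonempty (V ⊕ J) := ⟨Sum.inl r⟩
  exists_treeIso (branching dL dR k) (prefixClosed_regularTree _ _ _)
    (prefixClosed_pathPrefixTree _ _ _) (nil_mem_regularTree _ _ _)
    (nil_mem_pathPrefixTree _ _ _) (pathPrefixTree_finite _ _ _)
    (fun _ => children_regularTree) fun _ => ncard_children_eq_branching hreg

/-! ### Pairings with deviations as values of trees. -/

/-- The value of `lam` at the variable node at the end of the path `p` (and `0` if the path ends in
a local-code node). -/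
def pathValue (J : Type*) (lam : V → ℝ) (r : V) (p : List (V ⊕ J)) : ℝ :=
  Sum.elim lam 0 (pathTarget (Sum.inl r) p)

theorem dTree_finite [Finite V] [Finite J] {h d : ℕ} {r : V} {τ : Set (List (V ⊕ J))}
    (hτ : τ ∈ C.dTrees h d r) : τ.Finite :=
  (pathPrefixTree_finite _ _ _).subset hτ.subset

/-- Exchange of summation: a path contributes only at the vertex where it ends, and paths ending in
local-code nodes have value 0 on the right. -/
theorem sum_mul_projection [Fintype V] [Finite J] {h d : ℕ} {r : V} {τ : Set (List (V ⊕ J))}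
    (hτ : τ ∈ C.dTrees h d r) (w : Fin h → ℝ) (lam : V → ℝ) :
    ∑ v, lam v * C.projection w r τ v =
      ∑ p ∈ (dTree_finite hτ).toFinset,
        subtreeWeight C.graph (Sum.inl r) w τ p * pathValue J lam r p := by
  classical
  have hproj : ∀ v, C.projection w r τ v = ∑ p ∈ (dTree_finite hτ).toFinset,
      if pathTarget (Sum.inl r) p = Sum.inl v then subtreeWeight C.graph (Sum.inl r) w τ p
      else 0 := by
    intro v
    rw [projection, finsum_mem_eq_finite_toFinset_sum _
      ((dTree_finite hτ).subset fun p hp => hp.1), ← Finset.sum_filter]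
    refine Finset.sum_congr ?_ fun _ _ => rfl
    ext p
    simp
  simp_rw [hproj, Finset.mul_sum]
  rw [Finset.sum_comm]
  refine Finset.sum_congr rfl fun p _ => ?_
  rcases ht : pathTarget (Sum.inl r) p with u | j
  · simp [pathValue, ht, mul_comm]
  · simp [pathValue, ht]

theorem treeDeg_dTree_of_odd {h d : ℕ} {r : V} {τ : Set (List (V ⊕ J))}
    (hτ : τ ∈ C.dTrees h d r) {p : List (V ⊕ J)} (hp : p ∈ τ) (hodd : Odd p.length) :
    treeDeg τ p = d := hτ.local_code p hp hodd

theorem treeDeg_dTree_of_even [Finite V] [Finite J] {dL dR : ℕ} (hreg : C.IsRegular dL dR)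
    {h d : ℕ} {r : V} {τ : Set (List (V ⊕ J))} (hτ : τ ∈ C.dTrees h d r) {p : List (V ⊕ J)}
    (hp : p ∈ τ) (heven : Even p.length) (h0 : p ≠ []) (hh : p.length < 2 * h) :
    treeDeg τ p = dL := by
  have hpT := hτ.subset hp
  rw [hτ.variable_node p hp heven, treeDeg_eq_ncard_children (prefixClosed_pathPrefixTree _ _ _)
    hpT (children_finite (pathPrefixTree_finite _ _ _) _), ncard_children_pathPrefixTree hpT hh]
  obtain ⟨v, hv⟩ := exists_pathTarget_eq_inl hpT heven
  rw [hv, hreg.1]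
  obtain rfl | ⟨q, b, rfl⟩ := p.eq_nil_or_concat
  · exact absurd rfl h0
  · rw [List.concat_eq_append] at hpT hv
    have hadj := (adj_of_concat_mem hpT).symm
    rw [pathTarget_concat] at hv
    rw [hv] at hadj
    -- The parent is a neighbour of v, so dL > 0 and (dL - 1) + 1 = dL holds despite truncated
    -- subtraction.
    have : 0 < vertexDeg C.graph (Sum.inl v) :=
      (Set.ncard_pos (Set.toFinite _)).2 ⟨_, hadj⟩
    rw [hreg.1] at this
    simp
    omega

/-- The range contains the m + 1 odd depths, where the degree is d, and the m positive even depths,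
where it is dL. -/
theorem prod_inv_treeDeg [Finite V] [Finite J] {dL dR : ℕ} (hreg : C.IsRegular dL dR)
    {h d : ℕ} {r : V} {τ : Set (List (V ⊕ J))} (hτ : τ ∈ C.dTrees h d r) {p : List (V ⊕ J)}
    (hp : p ∈ τ) (m : ℕ) (hm : 2 * (m + 1) ≤ p.length) :
    ∏ k ∈ Finset.Ico 1 (2 * (m + 1)), 1 / ((treeDeg τ (p.take k) : ℝ) - 1) =
      ((dL : ℝ) - 1)⁻¹ ^ m * ((d : ℝ) - 1)⁻¹ ^ (m + 1) := by
  have hlen := (hτ.subset hp).1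
  have hmem : ∀ k, p.take k ∈ τ := fun k => hτ.prefixClosed _ hp _ (List.take_prefix k p)
  have hodd : ∀ k, 2 * k + 1 ≤ p.length → treeDeg τ (p.take (2 * k + 1)) = d := fun k hk =>
    treeDeg_dTree_of_odd hτ (hmem _) ⟨k, by rw [List.length_take]; omega⟩
  have heven : ∀ k, 2 * (k + 1) < p.length → treeDeg τ (p.take (2 * (k + 1))) = dL := by
    intro k hk
    have hl : (p.take (2 * (k + 1))).length = 2 * (k + 1) := by rw [List.length_take]; omega
    exact treeDeg_dTree_of_even hreg hτ (hmem _) ⟨k + 1, by omega⟩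
      (by intro h0; rw [h0] at hl; simp at hl) (by omega)
  induction m with
  | zero => simp [hodd 0 (by omega)]
  | succ m ih =>
    rw [show 2 * (m + 1 + 1) = 2 * (m + 1) + 1 + 1 by ring,
      Finset.prod_Ico_succ_top (by omega), Finset.prod_Ico_succ_top (by omega),
      ih (by omega), heven m (by omega), hodd (m + 1) (by omega)]
    simp only [one_div]
    ring

/-- With h = l + m + 1 the path has length 2(m + 1), so its level is h - l and the product of
inverse degrees supplies the two negative powers in `processWeight`. -/
theorem subtreeWeight_eq [Finite V] [Finite J] {dL dR : ℕ} (hreg : C.IsRegular dL dR)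
    {h d : ℕ} {r : V} {τ : Set (List (V ⊕ J))} (hτ : τ ∈ C.dTrees h d r) (w : Fin h → ℝ)
    (l : Fin h) {p : List (V ⊕ J)} (hp : p ∈ τ) (hlen : p.length + 2 * (l : ℕ) = 2 * h) :
    subtreeWeight C.graph (Sum.inl r) w τ p = processWeight d dL w l / ∑ i, |w i| := by
  have hl := l.2
  obtain ⟨m, hm⟩ : ∃ m, h = l + (m + 1) := ⟨h - l - 1, by omega⟩
  have hpl : p.length = 2 * (m + 1) := by omega
  have hne : p ≠ [] := by rintro rfl; simp at hpl
  obtain ⟨v, hv⟩ := exists_pathTarget_eq_inl (hτ.subset hp) ⟨m + 1, by omega⟩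
  rw [subtreeWeight, if_neg hne, hv, hreg.1, hpl, prod_inv_treeDeg hreg hτ hp m hpl.ge,
    processWeight]
  have e1 : (2 * (m + 1) + 1) / 2 = h - l := by omega
  have e2 : ((l : ℕ) : ℤ) - (h : ℤ) + 1 = -(m : ℤ) := by omega
  have e3 : ((l : ℕ) : ℤ) - (h : ℤ) = -((m + 1 : ℕ) : ℤ) := by omega
  rw [e1, e2, e3, zpow_neg, zpow_neg, zpow_natCast, zpow_natCast, ← inv_pow, ← inv_pow]
  ring

theorem sum_mul_projection_eq_treeValue [Fintype V] [Finite J] {dL dR : ℕ}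
    (hreg : C.IsRegular dL dR) {h d : ℕ} {r : V} {τ : Set (List (V ⊕ J))}
    (hτ : τ ∈ C.dTrees h d r) (w : Fin h → ℝ) (lam : V → ℝ) :
    ∑ v, lam v * C.projection w r τ v =
      treeValue (processWeight d dL w) τ (pathValue J lam r) / ∑ i, |w i| := by
  classical
  rw [sum_mul_projection hτ, treeValue, Finset.sum_div]
  have hlev : ∀ l : Fin h, (∑ᶠ p ∈ {p : List (V ⊕ J) | p ∈ τ ∧ p.length + 2 * (l : ℕ) = 2 * h},
      processWeight d dL w l * pathValue J lam r p) / ∑ i, |w i| =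
      ∑ p ∈ (dTree_finite hτ).toFinset, if p.length + 2 * (l : ℕ) = 2 * h then
        subtreeWeight C.graph (Sum.inl r) w τ p * pathValue J lam r p else 0 := by
    intro l
    rw [finsum_mem_eq_finite_toFinset_sum _ ((dTree_finite hτ).subset fun p hp => hp.1),
      ← Finset.sum_filter, Finset.sum_div]
    refine Finset.sum_congr (by ext p; simp) fun p hp => ?_
    simp only [Finset.mem_filter, Set.Finite.mem_toFinset] at hp
    rw [subtreeWeight_eq hreg hτ w l hp.1 hp.2]
    ring
  simp_rw [hlev]
  rw [Finset.sum_comm]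
  refine Finset.sum_congr rfl fun p hp => ?_
  rw [Set.Finite.mem_toFinset] at hp
  have hpT := hτ.subset hp
  have hlen := hpT.1
  by_cases hne : p = []
  · subst hne
    simp [subtreeWeight]
  · have hpos := List.length_pos_iff.2 hne
    rcases Nat.even_or_odd p.length with heven | hodd
    · obtain ⟨m, hm⟩ := heven
      -- A node at depth 2m > 0 lies on exactly one level, l = h - m.
      rw [Finset.sum_eq_single_of_mem (⟨h - m, by omega⟩ : Fin h) (Finset.mem_univ _)]
      · rw [if_pos (by simp; omega)]
      · intro l _ hl
        rw [if_neg]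
        intro h'
        exact hl (Fin.ext (by simp; omega))
    · obtain ⟨j, hj⟩ := exists_pathTarget_eq_inr hpT hodd
      simp [pathValue, hj]

theorem normConst_pos {h : ℕ} (w : Fin h → ℝ) (d : ℕ) : 0 < C.normConst w d :=
  lt_of_lt_of_le one_pos (le_max_left _ _)

theorem subtreeWeight_nonneg [Finite V] [Finite J] {dL dR : ℕ} (hreg : C.IsRegular dL dR)
    {h d : ℕ} (hd : 1 ≤ d) {r : V} {τ : Set (List (V ⊕ J))} (hτ : τ ∈ C.dTrees h d r)
    {w : Fin h → ℝ} (hw : ∀ i, 0 ≤ w i) {p : List (V ⊕ J)} (hp : p ∈ τ)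
    {v : V} (hv : pathTarget (Sum.inl r) p = Sum.inl v) :
    0 ≤ subtreeWeight C.graph (Sum.inl r) w τ p := by
  by_cases hne : p = []
  · simp [subtreeWeight, hne]
  have hpos := List.length_pos_iff.2 hne
  obtain ⟨m, hm⟩ := (isLeft_pathTarget (hτ.subset hp)).1 (by rw [hv]; rfl)
  have hlen := (hτ.subset hp).1
  rw [subtreeWeight_eq hreg hτ w ⟨h - m, by omega⟩ hp (by simp; omega), processWeight]
  -- For dL = 0 the factor dL - 1 is negative, but then the factor dL⁻¹ is 0.
  have hdL : (0 : ℝ) ≤ (dL : ℝ) - 1 ∨ dL = 0 := by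
    rcases Nat.eq_zero_or_pos dL with h | h
    · exact Or.inr h
    · left
      have : (1 : ℝ) ≤ dL := by exact_mod_cast h
      linarith
  have hd' : (0 : ℝ) ≤ (d : ℝ) - 1 := by
    have : (1 : ℝ) ≤ d := by exact_mod_cast hd
    linarith
  have hl : ∀ n, 0 ≤ levelWeight w n := fun n => by
    rw [levelWeight]; split_ifs
    · exact hw _
    · exact le_rfl
  have hs : 0 ≤ ∑ i, |w i| := Finset.sum_nonneg fun i _ => abs_nonneg _
  rcases hdL with hdL | hdL
  · have := hl (h - (h - m))
    positivity
  · simp [hdL]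

theorem projection_nonneg [Finite V] [Finite J] {dL dR : ℕ} (hreg : C.IsRegular dL dR)
    {h d : ℕ} (hd : 1 ≤ d) {r : V} {τ : Set (List (V ⊕ J))} (hτ : τ ∈ C.dTrees h d r)
    {w : Fin h → ℝ} (hw : ∀ i, 0 ≤ w i) (v : V) : 0 ≤ C.projection w r τ v :=
  finsum_nonneg fun _ => finsum_nonneg fun hp => subtreeWeight_nonneg hreg hd hτ hw hp.1 hp.2

/-- The all-zero word is locally optimal when all `d`-trees have positive value. -/
theorem isLocallyOptimal_zero_iff [Fintype V] [Finite J] {dL dR : ℕ} (hreg : C.IsRegular dL dR)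
    {h d : ℕ} (hd : 1 ≤ d) {w : Fin h → ℝ} (hw : ∀ i, 0 ≤ w i) (hw0 : w ≠ 0) (lam : V → ℝ) :
    C.IsLocallyOptimal w d lam 0 ↔ ∀ r, ∀ τ ∈ C.dTrees h d r,
      0 < treeValue (processWeight d dL w) τ (pathValue J lam r) := by
  have hcode : (0 : V → ZMod 2) ∈ C.code :=
    Set.mem_iInter.2 fun j => (C.localCode j).zero_mem
  have hsum : 0 < ∑ i, |w i| := by
    obtain ⟨i, hi⟩ := Function.ne_iff.1 hw0
    exact Finset.sum_pos' (fun i _ => abs_nonneg _) ⟨i, Finset.mem_univ _, abs_pos.2 hi⟩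
  have hc : 0 < 1 / C.normConst w d := one_div_pos.2 (normConst_pos w d)
  -- Nonnegativity of the projection removes the absolute value. Of the normalizing constant only
  -- positivity is used.
  have key : ∀ r, ∀ τ ∈ C.dTrees h d r,
      ∑ v, lam v * |realWord (0 : V → ZMod 2) v - 1 / C.normConst w d * C.projection w r τ v| =
        1 / C.normConst w d *
          (treeValue (processWeight d dL w) τ (pathValue J lam r) / ∑ i, |w i|) := by
    intro r τ hτ
    rw [← sum_mul_projection_eq_treeValue hreg hτ, Finset.mul_sum]
    refine Finset.sum_congr rfl fun v _ => ?_
    have h0 : realWord (0 : V → ZMod 2) v = 0 := by simp [realWord]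
    rw [h0, zero_sub, abs_neg, abs_of_nonneg (mul_nonneg hc.le (projection_nonneg hreg hd hτ hw v))]
    ring
  have hzero : ∑ v, lam v * realWord (0 : V → ZMod 2) v = 0 := by simp [realWord]
  simp only [IsLocallyOptimal, hzero]
  constructor
  · rintro ⟨-, hloc⟩ r τ hτ
    have := hloc _ ⟨r, τ, hτ, rfl⟩
    rw [key r τ hτ] at this
    exact (div_pos_iff_of_pos_right hsum).1 (pos_of_mul_pos_right this hc.le)
  · intro hpos
    refine ⟨hcode, ?_⟩
    rintro _ ⟨r, τ, hτ, rfl⟩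
    rw [key r τ hτ]
    exact mul_pos hc (div_pos (hpos r τ hτ) hsum)

end TannerCode

/-! ### Backtrackless walks shorter than the girth. -/

section Girth

variable {α : Type*} {G : SimpleGraph α}

/-- Turns the condition on triples of vertices into one on consecutive edges, the form in which
backtrackless walks in acyclic graphs are known to be paths. -/
theorem isChain_ne_edges : ∀ {u v : α} (p : G.Walk u v),
    (∀ a b c, [a, b, c] <:+: p.support → s(a, b) ≠ s(b, c)) → p.edges.IsChain (· ≠ ·)
  | _, _, .nil, _ => by simp
  | _, _, .cons _ .nil, _ => by simp
  | u, _, .cons (v := v) h (.cons (v := x) h' p), hp => by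
    have ih := isChain_ne_edges (.cons h' p) fun a b c habc => hp a b c (by
      rw [SimpleGraph.Walk.support_cons]
      exact List.infix_cons habc)
    rw [SimpleGraph.Walk.edges_cons, SimpleGraph.Walk.edges_cons, List.isChain_cons_cons]
    refine ⟨hp u v x ?_, by rwa [SimpleGraph.Walk.edges_cons] at ih⟩
    obtain ⟨t, ht⟩ : ∃ t, p.support = x :: t := ⟨_, p.cons_tail_support.symm⟩
    rw [SimpleGraph.Walk.support_cons, SimpleGraph.Walk.support_cons, ht]
    exact (List.prefix_append [u, v, x] t).isInfix

/-- Two backtrackless walks with the same ends, of total length less than the girth, coincide. -/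
theorem walk_eq_of_length_lt_egirth {u v : α} {p q : G.Walk u v}
    (hp : p.edges.IsChain (· ≠ ·)) (hq : q.edges.IsChain (· ≠ ·))
    (hlen : ((p.length + q.length : ℕ) : ℕ∞) < G.egirth) : p = q := by
  classical
  let s : Finset (Sym2 α) := p.edges.toFinset ∪ q.edges.toFinset
  let H : SimpleGraph α := SimpleGraph.fromEdgeSet (s : Set (Sym2 α))
  have hps : ∀ e ∈ p.edges, e ∈ H.edgeSet := fun e he => by
    rw [SimpleGraph.edgeSet_fromEdgeSet]
    exact ⟨by simp [s, he], G.not_isDiag_of_mem_edgeSet (p.edges_subset_edgeSet he)⟩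
  have hqs : ∀ e ∈ q.edges, e ∈ H.edgeSet := fun e he => by
    rw [SimpleGraph.edgeSet_fromEdgeSet]
    exact ⟨by simp [s, he], G.not_isDiag_of_mem_edgeSet (q.edges_subset_edgeSet he)⟩
  have hHs : ∀ e ∈ H.edgeSet, e ∈ s := fun e he => by
    rw [SimpleGraph.edgeSet_fromEdgeSet] at he
    exact he.1
  have hsG : ∀ e ∈ s, e ∈ G.edgeSet := fun e he => by
    rcases Finset.mem_union.1 he with he | he
    · exact p.edges_subset_edgeSet (List.mem_toFinset.1 he)
    · exact q.edges_subset_edgeSet (List.mem_toFinset.1 he)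
  have hHG : H ≤ G := SimpleGraph.edgeSet_subset_edgeSet.1 fun e he => hsG e (hHs e he)
  -- H consists of the edges of p and q. A cycle in H is a cycle of G with at most |p| + |q| edges,
  -- which is below the girth. In an acyclic graph backtrackless walks are paths, and paths with
  -- given ends are unique.
  have hacyc : H.IsAcyclic := by
    intro a c hc
    have h1 : G.egirth ≤ c.length := by
      have := SimpleGraph.egirth_le_length (hc.mapLe hHG)
      simpa using this
    have h2 : c.length ≤ p.length + q.length := by
      rw [← c.length_edges, ← List.toFinset_card_of_nodup hc.edges_nodup, ← p.length_edges,
        ← q.length_edges]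
      refine (Finset.card_le_card (t := s) fun e he => hHs e
        (c.edges_subset_edgeSet (List.mem_toFinset.1 he))).trans ?_
      exact (Finset.card_union_le _ _).trans
        (add_le_add (List.toFinset_card_le _) (List.toFinset_card_le _))
    exact absurd (h1.trans (by exact_mod_cast h2)) (not_le.2 hlen)
  have hp' : (p.transfer H hps).IsPath := by
    rw [hacyc.isPath_iff_isChain, SimpleGraph.Walk.edges_transfer]; exact hp
  have hq' : (q.transfer H hqs).IsPath := by
    rw [hacyc.isPath_iff_isChain, SimpleGraph.Walk.edges_transfer]; exact hq
  have := congrArg Subtype.val 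
    ((hacyc.subsingleton_path u v).elim ⟨_, hp'⟩ ⟨_, hq'⟩)
  apply SimpleGraph.Walk.ext_support
  have := congrArg SimpleGraph.Walk.support this
  simpa using this

theorem exists_walk_of_isChain : ∀ (r : α) (p : List α), (r :: p).IsChain G.Adj →
    ∃ W : G.Walk r (pathTarget r p), W.support = r :: p
  | r, [], _ => ⟨.nil, rfl⟩
  | r, a :: p, h => by
    rw [List.isChain_cons_cons] at h
    obtain ⟨W, hW⟩ := exists_walk_of_isChain a p h.2
    have : pathTarget r (a :: p) = pathTarget a p := by
      cases p <;> simp [pathTarget, List.getLastD]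
    rw [this]
    exact ⟨.cons h.1 W, by rw [SimpleGraph.Walk.support_cons, hW]⟩

/-- Two nodes with the same target are backtrackless walks with the same ends and total length at
most 2k. For trees of height 2h this is where girth above 4h is needed. -/
theorem injOn_pathTarget {r : α} {k : ℕ} (hk : ((2 * k : ℕ) : ℕ∞) < G.egirth) :
    Set.InjOn (pathTarget r) (pathPrefixTree G r k) := by
  intro p hp q hq hpq
  obtain ⟨W, hW⟩ := exists_walk_of_isChain r p hp.2.1
  obtain ⟨W', hW'⟩ : ∃ W' : G.Walk r (pathTarget r p), W'.support = r :: q := by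
    rw [hpq]
    exact exists_walk_of_isChain r q hq.2.1
  have hlen : W.length = p.length ∧ W'.length = q.length := by
    constructor
    · have := W.length_support; rw [hW] at this; simpa using this.symm
    · have := W'.length_support; rw [hW'] at this; simpa using this.symm
  have hWW := walk_eq_of_length_lt_egirth (p := W) (q := W')
    (isChain_ne_edges W (by rw [hW]; exact hp.2.2))
    (isChain_ne_edges W' (by rw [hW']; exact hq.2.2)) (lt_of_le_of_lt ?_ hk)
  · rw [hWW, hW'] at hW
    exact (List.cons.inj hW).2.symm
  · have := hp.1
    have := hq.1
    exact_mod_cast (by omega : W.length + W'.length ≤ 2 * k)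

end Girth

/-! ### Averages over subsets of fixed size. -/

section Averaging

variable {V : Type*}

/-- If `a` is at most the average of `F` over each `m`-subset of `B`, then it is at most the average
of `F` over `B`. -/
theorem card_mul_le_sum_of_forall_subset [DecidableEq V] (F : V → ℝ) (a : ℝ) {m : ℕ} (hm : 1 ≤ m)
    (B : Finset V) (hB : m ≤ B.card)
    (hS : ∀ S ⊆ B, S.card = m → (m : ℝ) * a ≤ ∑ u ∈ S, F u) :
    (B.card : ℝ) * a ≤ ∑ u ∈ B, F u := by
  induction hn : B.card generalizing B with
  | zero => omega
  | succ n ih =>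
    rcases hB.eq_or_lt with h | h
    · rw [← hn, ← h]
      exact hS B subset_rfl h.symm
    · have hstep : ∀ b ∈ B, (n : ℝ) * a ≤ (∑ u ∈ B, F u) - F b := by
        intro b hb
        have hc : (B.erase b).card = n := by rw [Finset.card_erase_of_mem hb]; omega
        have := ih (B.erase b) (by omega)
          (fun S hS' => hS S (hS'.trans (Finset.erase_subset _ _))) hc
        rwa [← Finset.sum_erase_add B F hb, add_sub_cancel_right]
      have hsum := Finset.sum_le_sum hstep
      rw [Finset.sum_const, Finset.sum_sub_distrib, Finset.sum_const, hn, nsmul_eq_mul,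
        nsmul_eq_mul] at hsum
      have hn0 : (0 : ℝ) < n := by
        have : 0 < n := by omega
        exact_mod_cast this
      push_cast at hsum ⊢
      nlinarith

theorem exists_minimal_subset [DecidableEq V] (B : Finset V) {m : ℕ} (hm : m ≤ B.card)
    (F : V → ℝ) : ∃ S ⊆ B, S.card = m ∧
      ∀ S' ⊆ B, S'.card = m → ∑ u ∈ S, F u ≤ ∑ u ∈ S', F u := by
  obtain ⟨S, hS, hmin⟩ := (Finset.powersetCard m B).exists_min_image (fun S => ∑ u ∈ S, F u)
    (Finset.powersetCard_nonempty.2 hm)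
  rw [Finset.mem_powersetCard] at hS
  exact ⟨S, hS.1, hS.2, fun S' h1 h2 => hmin S' (Finset.mem_powersetCard.2 ⟨h1, h2⟩)⟩

end Averaging

theorem realWord_eq_ite {V : Type*} (x : V → ZMod 2) (v : V) :
    realWord x v = if x v ≠ 0 then 1 else 0 := by
  have h : ∀ a : ZMod 2, a.val = if a ≠ 0 then 1 else 0 := by decide
  rw [realWord, h]
  split_ifs <;> simp

theorem realWord_zero {V : Type*} : realWord (0 : V → ZMod 2) = 0 := by
  ext v; simp [realWord]

/-! ### Inequalities on the convex hulls of the local codes. -/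

namespace TannerCode

variable {V J : Type*} {C : TannerCode V J}

/-- The neighbours of the local-code node `j`, as a finite set. -/
def nbrFinset (C : TannerCode V J) (j : J) : Finset V := Finset.univ.map (C.nbr j)

theorem mem_nbrFinset {j : J} {v : V} : v ∈ C.nbrFinset j ↔ v ∈ C.nbrSet j := by
  simp [nbrFinset, nbrSet]

theorem card_nbrFinset_of_isRegular {dL dR : ℕ} (hreg : C.IsRegular dL dR) (j : J) :
    (C.nbrFinset j).card = dR := by
  rw [← hreg.2 j, vertexDeg_inr, ← Set.ncard_coe_finset]
  congr 1
  ext v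
  exact mem_nbrFinset

/-- A local codeword that does not vanish has weight at least `d*`. -/
theorem le_card_support {d : ℕ} (hd : (d : ℕ∞) ≤ C.minLocalDist) {j : J} {c : V → ZMod 2}
    (hc : c ∈ C.extendedLocalCode j) {v : V} (hv : v ∈ C.nbrFinset j) (hcv : c v ≠ 0) :
    d ≤ ((C.nbrFinset j).filter fun v => c v ≠ 0).card := by
  obtain ⟨i, -, rfl⟩ := Finset.mem_map.1 hv
  have h0 : (fun i => c (C.nbr j i)) ≠ 0 := fun h => hcv (congrFun h i)
  have h1 : (d : ℕ∞) ≤ ((hammingNorm fun i => c (C.nbr j i) : ℕ) : ℕ∞) :=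
    hd.trans ((iInf_le _ j).trans ((iInf_le _ _).trans ((iInf_le _ hc).trans (iInf_le _ h0))))
  have h2 : d ≤ hammingNorm fun i => c (C.nbr j i) := by exact_mod_cast h1
  rwa [nbrFinset, Finset.filter_map, Finset.card_map]

/-- A nonempty support B has at least d points, so for v in B the averaging lemma on B without v
gives (|B| - 1) A v ≤ ∑_B F - F v. Summing over v in B counts each F u exactly |B| - 1 times. -/
theorem sum_realWord_mul_le [DecidableEq V] {d : ℕ} (hd2 : 2 ≤ d) (hd : (d : ℕ∞) ≤ C.minLocalDist)
    {j : J} {c : V → ZMod 2} (hc : c ∈ C.extendedLocalCode j) (A F : V → ℝ)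
    (hAF : ∀ v ∈ C.nbrFinset j, ∀ S ⊆ (C.nbrFinset j).erase v, S.card = d - 1 →
      ((d - 1 : ℕ) : ℝ) * A v ≤ ∑ u ∈ S, F u) :
    ∑ v ∈ C.nbrFinset j, realWord c v * A v ≤ ∑ v ∈ C.nbrFinset j, realWord c v * F v := by
  simp_rw [realWord_eq_ite, ite_mul, one_mul, zero_mul, ← Finset.sum_filter]
  set B := (C.nbrFinset j).filter fun v => c v ≠ 0 with hB
  rcases B.eq_empty_or_nonempty with h | ⟨v₀, hv₀⟩
  · rw [h]; simp
  · have hcard : d ≤ B.card :=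
      le_card_support hd hc (Finset.mem_filter.1 hv₀).1 (Finset.mem_filter.1 hv₀).2
    obtain ⟨k, hk⟩ : ∃ k, B.card = k + 1 := ⟨B.card - 1, by omega⟩
    have hstep : ∀ v ∈ B, (k : ℝ) * A v ≤ (∑ u ∈ B, F u) - F v := by
      intro v hv
      have hc' : (B.erase v).card = k := by rw [Finset.card_erase_of_mem hv]; omega
      have := card_mul_le_sum_of_forall_subset F (A v) (m := d - 1) (by omega) (B.erase v)
        (by omega) fun S hS hSc => hAF v (Finset.mem_filter.1 hv).1 S
          (hS.trans (Finset.erase_subset_erase _ (Finset.filter_subset _ _))) hSc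
      rwa [hc', ← add_sub_cancel_right (∑ u ∈ B.erase v, F u) (F v),
        Finset.sum_erase_add B F hv] at this
    have hsum := Finset.sum_le_sum hstep
    rw [← Finset.mul_sum, Finset.sum_sub_distrib, Finset.sum_const, hk, nsmul_eq_mul] at hsum
    have hk0 : (0 : ℝ) < k := by
      have : 0 < k := by omega
      exact_mod_cast this
    push_cast at hsum
    have : (k : ℝ) * ∑ v ∈ B, A v ≤ k * ∑ v ∈ B, F v := by linarith
    exact le_of_mul_le_mul_left this hk0

/-- Both sides are linear in x, so the inequality for local codewords extends to their hull. -/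
theorem sum_mul_le_of_mem_convexHull [Fintype V] [DecidableEq V] {d : ℕ} (hd2 : 2 ≤ d)
    (hd : (d : ℕ∞) ≤ C.minLocalDist) {j : J} {x : V → ℝ}
    (hx : x ∈ convexHull ℝ (realWord '' C.extendedLocalCode j)) (A F : V → ℝ)
    (hAF : ∀ v ∈ C.nbrFinset j, ∀ S ⊆ (C.nbrFinset j).erase v, S.card = d - 1 →
      ((d - 1 : ℕ) : ℝ) * A v ≤ ∑ u ∈ S, F u) :
    ∑ v ∈ C.nbrFinset j, x v * A v ≤ ∑ v ∈ C.nbrFinset j, x v * F v := by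
  have hconv : Convex ℝ {x : V → ℝ | ∑ v ∈ C.nbrFinset j, x v * A v ≤
      ∑ v ∈ C.nbrFinset j, x v * F v} := by
    intro x hx y hy a b ha hb _
    simp only [Set.mem_ofPred_eq, Pi.add_apply, Pi.smul_apply, smul_eq_mul, add_mul,
      Finset.sum_add_distrib, mul_assoc, ← Finset.mul_sum] at hx hy ⊢
    exact add_le_add (mul_le_mul_of_nonneg_left hx ha) (mul_le_mul_of_nonneg_left hy hb)
  refine convexHull_min ?_ hconv hx
  rintro _ ⟨c, hc, rfl⟩
  exact sum_realWord_mul_le hd2 hd hc A F hAF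

theorem nonneg_of_mem_convexHull {j : J} {x : V → ℝ}
    (hx : x ∈ convexHull ℝ (realWord '' C.extendedLocalCode j)) (v : V) : 0 ≤ x v := by
  have hconv : Convex ℝ {x : V → ℝ | 0 ≤ x v} := by
    intro x hx y hy a b ha hb _
    exact add_nonneg (mul_nonneg ha hx) (mul_nonneg hb hy)
  refine convexHull_min ?_ hconv hx
  rintro _ ⟨c, -, rfl⟩
  exact Nat.cast_nonneg (α := ℝ) (c v).val

theorem exists_ne_zero_of_mem_convexHull {j : J} {x : V → ℝ}
    (hx : x ∈ convexHull ℝ (realWord '' C.extendedLocalCode j)) {v : V} (hv : x v ≠ 0) :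
    ∃ c ∈ C.extendedLocalCode j, c v ≠ 0 := by
  by_contra! hcon
  have hconv : Convex ℝ {x : V → ℝ | x v = 0} := by
    intro x hx y hy a b _ _ _
    simp only [Set.mem_ofPred_eq] at hx hy
    simp [hx, hy]
  refine hv (convexHull_min ?_ hconv hx)
  rintro _ ⟨c, hc, rfl⟩
  simp [realWord, hcon c hc]

theorem realWord_zero_mem_fundamentalPolytope :
    realWord (0 : V → ZMod 2) ∈ C.fundamentalPolytope :=
  Set.mem_iInter.2 fun j => subset_convexHull ℝ _ ⟨0, (C.localCode j).zero_mem, rfl⟩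

/-! ### The dynamic program and the d-tree that it selects. -/

/-- The other local-code nodes at the variable node `u`, when `u` is reached from `j`. -/
noncomputable def otherNbrs [Fintype J] (C : TannerCode V J) (j : J) (u : V) : Finset J :=
  open scoped Classical in {j' | u ∈ C.nbrSet j' ∧ j' ≠ j}

theorem mem_otherNbrs [Fintype J] {j j' : J} {u : V} :
    j' ∈ C.otherNbrs j u ↔ u ∈ C.nbrSet j' ∧ j' ≠ j := by
  simp [otherNbrs]

/-- The value of the variable node `u` reached from `j`, when `A` gives the values of the local-code
nodes below it. -/
noncomputable def nodeValue [Fintype J] (C : TannerCode V J) (a t : ℝ) (lam : V → ℝ)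
    (A : J → V → ℝ) (j : J) (u : V) : ℝ :=
  a * lam u + t * ∑ j' ∈ C.otherNbrs j u, A j' u

/-- A solution of the dynamic program that minimizes the value of a `d`-tree: `A k j v` is the
minimal value of the part below the local-code node `j` reached from `v`, with `k` more levels of
variable nodes, and `σ k j v` is the set of children of `j` in a minimizer. -/
structure IsMinimizer [Fintype J] [DecidableEq V] (C : TannerCode V J) (d : ℕ) (a : ℕ → ℝ) (t : ℝ)
    (lam : V → ℝ) (A : ℕ → J → V → ℝ) (σ : ℕ → J → V → Finset V) : Prop where
  zero : A 0 = 0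
  subset : ∀ k j, ∀ v ∈ C.nbrFinset j, σ k j v ⊆ (C.nbrFinset j).erase v
  card : ∀ k j, ∀ v ∈ C.nbrFinset j, (σ k j v).card = d - 1
  succ : ∀ k j v, A (k + 1) j v =
    ((d : ℝ) - 1)⁻¹ * ∑ u ∈ σ k j v, C.nodeValue (a k) t lam (A k) j u
  min : ∀ k j, ∀ v ∈ C.nbrFinset j, ∀ S ⊆ (C.nbrFinset j).erase v, S.card = d - 1 →
    ∑ u ∈ σ k j v, C.nodeValue (a k) t lam (A k) j u ≤
      ∑ u ∈ S, C.nodeValue (a k) t lam (A k) j u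

theorem exists_isMinimizer [Fintype J] [DecidableEq V] {d : ℕ}
    (hd : ∀ j, ∀ v ∈ C.nbrFinset j, d ≤ (C.nbrFinset j).card) (a : ℕ → ℝ) (t : ℝ) (lam : V → ℝ) :
    ∃ A σ, C.IsMinimizer d a t lam A σ := by
  have hsel : ∀ (F : V → ℝ) (j : J) (v : V), ∃ S : Finset V, v ∈ C.nbrFinset j →
      S ⊆ (C.nbrFinset j).erase v ∧ S.card = d - 1 ∧
      ∀ S' ⊆ (C.nbrFinset j).erase v, S'.card = d - 1 → ∑ u ∈ S, F u ≤ ∑ u ∈ S', F u := by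
    intro F j v
    by_cases hv : v ∈ C.nbrFinset j
    · obtain ⟨S, hS⟩ := exists_minimal_subset ((C.nbrFinset j).erase v) (m := d - 1)
        (by rw [Finset.card_erase_of_mem hv]; have := hd j v hv; omega) F
      exact ⟨S, fun _ => hS⟩
    · exact ⟨∅, fun h => absurd h hv⟩
  choose sel hsel using hsel
  -- The cost at step k depends only on A k, so A is built by recursion and σ k is then read off as
  -- the cheapest choice for that cost.
  let A : ℕ → J → V → ℝ := fun k => Nat.rec (motive := fun _ => J → V → ℝ) 0
    (fun k A j v => ((d : ℝ) - 1)⁻¹ *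
      ∑ u ∈ sel (C.nodeValue (a k) t lam A j) j v, C.nodeValue (a k) t lam A j u) k
  refine ⟨A, fun k j v => sel (C.nodeValue (a k) t lam (A k) j) j v, rfl, ?_, ?_, ?_, ?_⟩
  · exact fun k j v hv => (hsel _ j v hv).1
  · exact fun k j v hv => (hsel _ j v hv).2.1
  · exact fun k j v => rfl
  · exact fun k j v hv => (hsel _ j v hv).2.2

/-- The subtree of the path-prefix tree of height `2 * h` in which the children of the local-code
nodes are those selected by `σ`. -/
def selectedTree (C : TannerCode V J) (h : ℕ) (σ : ℕ → J → V → Finset V) (r : V) :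
    Set (List (V ⊕ J)) :=
  {p | p ∈ pathPrefixTree C.graph (Sum.inl r) (2 * h) ∧ ∀ q j u v,
    q ++ [Sum.inr j] ++ [Sum.inl u] <+: p → pathTarget (Sum.inl r) q = Sum.inl v →
      u ∈ σ (h - 1 - q.length / 2) j v}

section SelectedTree

variable {h : ℕ} {σ : ℕ → J → V → Finset V} {r : V}

theorem prefixClosed_selectedTree : PrefixClosed (C.selectedTree h σ r) :=
  fun _ hq _ hpq => ⟨prefixClosed_pathPrefixTree _ _ _ _ hq.1 _ hpq,
    fun q j u v hpre => hq.2 q j u v (hpre.trans hpq)⟩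

theorem selectedTree_finite [Finite V] [Finite J] : (C.selectedTree h σ r).Finite :=
  (pathPrefixTree_finite _ _ _).subset fun _ hp => hp.1

theorem nil_mem_selectedTree : [] ∈ C.selectedTree h σ r := by
  refine ⟨nil_mem_pathPrefixTree _ _ _, fun q j u v hpre => ?_⟩
  simp at hpre

theorem concat_mem_selectedTree_of_even {p : List (V ⊕ J)} {a : V ⊕ J}
    (hp : p ∈ C.selectedTree h σ r) (heven : Even p.length) :
    p ++ [a] ∈ C.selectedTree h σ r ↔
      p ++ [a] ∈ pathPrefixTree C.graph (Sum.inl r) (2 * h) := by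
  refine ⟨fun h => h.1, fun hpa => ⟨hpa, fun q j u v hpre hv => ?_⟩⟩
  obtain heq | hpre := List.prefix_concat_iff.1 hpre
  · obtain ⟨rfl, ha⟩ := List.append_inj' heq rfl
    have := (isLeft_pathTarget hp.1).2 heven
    simp [pathTarget_concat] at this
  · exact hp.2 q j u v hpre hv

theorem concat_mem_selectedTree_of_odd {q : List (V ⊕ J)} {j : J} {u v : V}
    (hq : q ++ [Sum.inr j] ∈ C.selectedTree h σ r) (hv : pathTarget (Sum.inl r) q = Sum.inl v) :
    q ++ [Sum.inr j] ++ [Sum.inl u] ∈ C.selectedTree h σ r ↔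
      q ++ [Sum.inr j] ++ [Sum.inl u] ∈ pathPrefixTree C.graph (Sum.inl r) (2 * h) ∧
        u ∈ σ (h - 1 - q.length / 2) j v := by
  refine ⟨fun h => ⟨h.1, h.2 q j u v List.prefix_rfl hv⟩, fun ⟨hp, hu⟩ => ⟨hp, ?_⟩⟩
  intro q' j' u' v' hpre hv'
  obtain heq | hpre := List.prefix_concat_iff.1 hpre
  · obtain ⟨heq, ha⟩ := List.append_inj' heq rfl
    obtain ⟨rfl, hb⟩ := List.append_inj' heq rfl
    simp only [List.cons.injEq, Sum.inl.injEq, Sum.inr.injEq, and_true] at ha hb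
    subst ha hb
    rw [hv, Sum.inl.injEq] at hv'
    rwa [← hv']
  · exact hq.2 q' j' u' v' hpre hv'

theorem children_selectedTree_of_even {p : List (V ⊕ J)} (hp : p ∈ C.selectedTree h σ r)
    (heven : Even p.length) :
    children (C.selectedTree h σ r) p =
      children (pathPrefixTree C.graph (Sum.inl r) (2 * h)) p := by
  ext a
  exact concat_mem_selectedTree_of_even hp heven

theorem children_selectedTree_of_odd [DecidableEq V]
    (hσ : ∀ k j, ∀ v ∈ C.nbrFinset j, σ k j v ⊆ (C.nbrFinset j).erase v)
    {q : List (V ⊕ J)} {j : J} {v : V} (hq : q ++ [Sum.inr j] ∈ C.selectedTree h σ r)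
    (hv : pathTarget (Sum.inl r) q = Sum.inl v) :
    children (C.selectedTree h σ r) (q ++ [Sum.inr j]) =
      Sum.inl '' (σ (h - 1 - q.length / 2) j v : Set V) := by
  have hqT := prefixClosed_selectedTree.of_concat hq
  have heven : Even q.length := (isLeft_pathTarget hqT.1).1 (by rw [hv]; rfl)
  have hlen := hq.1.1
  rw [List.length_append, List.length_singleton] at hlen
  have hvj : v ∈ C.nbrFinset j := by
    have := adj_of_concat_mem hq.1
    rw [hv] at this
    exact mem_nbrFinset.2 (C.adj_inl_inr.1 this)
  ext a
  rw [mem_children]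
  rcases a with u | i
  · rw [concat_mem_selectedTree_of_odd hq hv, concat_concat_mem_pathPrefixTree, hv]
    simp only [Set.mem_image, Finset.mem_coe, Sum.inl.injEq, exists_eq_right]
    refine ⟨fun h => h.2, fun hu => ⟨⟨hq.1, ?_, ?_, ?_⟩, hu⟩⟩
    · obtain ⟨m, hm⟩ := heven
      omega
    · exact C.adj_inr_inl.2 (mem_nbrFinset.1 (Finset.mem_of_mem_erase (hσ _ _ _ hvj hu)))
    · simpa using Finset.ne_of_mem_erase (hσ _ _ _ hvj hu)
  · simp only [Set.mem_image, Finset.mem_coe, reduceCtorEq, and_false, exists_false, iff_false]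
    intro hi
    have := adj_of_concat_mem hi.1
    rw [pathTarget_concat] at this
    exact C.not_adj_inr_inr this

theorem selectedTree_mem_dTrees [Finite V] [Finite J] [DecidableEq V] {d : ℕ} (hd : 1 ≤ d)
    (hσ : ∀ k j, ∀ v ∈ C.nbrFinset j, σ k j v ⊆ (C.nbrFinset j).erase v)
    (hcard : ∀ k j, ∀ v ∈ C.nbrFinset j, (σ k j v).card = d - 1) :
    C.selectedTree h σ r ∈ C.dTrees h d r where
  subset _ hp := hp.1
  root_mem := nil_mem_selectedTree
  prefix_closed := prefixClosed_selectedTree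
  local_code p hp hodd := by
    rw [treeDeg_eq_ncard_children prefixClosed_selectedTree hp
      (children_finite selectedTree_finite _)]
    obtain ⟨j, hj⟩ := exists_pathTarget_eq_inr hp.1 hodd
    obtain rfl | ⟨q, b, rfl⟩ := p.eq_nil_or_concat
    · simp at hodd
    · rw [List.concat_eq_append] at hp hodd hj ⊢
      rw [pathTarget_concat] at hj
      subst hj
      obtain ⟨v, hv⟩ := exists_pathTarget_eq_inl (prefixClosed_selectedTree.of_concat hp).1
        (by simpa [Nat.odd_add_one] using hodd)
      have hvj : v ∈ C.nbrFinset j := by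
        have := adj_of_concat_mem hp.1
        rw [hv] at this
        exact mem_nbrFinset.2 (C.adj_inl_inr.1 this)
      rw [children_selectedTree_of_odd hσ hp hv,
        Set.ncard_image_of_injective _ Sum.inl_injective, Set.ncard_coe_finset, hcard _ _ _ hvj]
      simp
      omega
  variable_node p hp heven := by
    rw [treeDeg_eq_ncard_children prefixClosed_selectedTree hp
      (children_finite selectedTree_finite _), children_selectedTree_of_even hp heven,
      treeDeg_eq_ncard_children (prefixClosed_pathPrefixTree _ _ _) hp.1
      (children_finite (pathPrefixTree_finite _ _ _) _)]

end SelectedTree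

/-! ### The value of the selected tree. -/

/-- A function of the pairs of a local-code node and a variable node, extended by `0`. -/
def edgeValue (A : J → V → ℝ) (x y : V ⊕ J) : ℝ :=
  Sum.elim (fun _ => 0) (fun j => Sum.elim (A j) (fun _ => 0) y) x

theorem edgeValue_inr_inl (A : J → V → ℝ) (j : J) (v : V) :
    edgeValue A (Sum.inr j) (Sum.inl v) = A j v := rfl

theorem edgeValue_zero (x y : V ⊕ J) : edgeValue (0 : J → V → ℝ) x y = 0 := by
  rcases x with x | x <;> rcases y with y | y <;> rfl

theorem children_eq_image_otherNbrs [Fintype J] {r : V} {k : ℕ} {q : List (V ⊕ J)} {j : J} {u : V}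
    (hq : q ++ [Sum.inr j] ++ [Sum.inl u] ∈ pathPrefixTree C.graph (Sum.inl r) k)
    (hk : q.length + 2 < k) :
    children (pathPrefixTree C.graph (Sum.inl r) k) (q ++ [Sum.inr j] ++ [Sum.inl u]) =
      Sum.inr '' (C.otherNbrs j u : Set J) := by
  rw [children_concat_pathPrefixTree hq (by simpa using hk), pathTarget_concat, neighborSet_inl]
  ext (v | i)
  · simp
  · simp [mem_otherNbrs]

variable [Fintype J] [DecidableEq V] {d h : ℕ} {a : ℕ → ℝ} {t : ℝ} {lam : V → ℝ}
  {A : ℕ → J → V → ℝ} {σ : ℕ → J → V → Finset V} {r : V}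

/-- One step of the recursion for A, read off the selected tree: the grandchildren of q through x
are the chosen neighbours, and below each of them hang all its other local-code nodes. -/
theorem IsMinimizer.finsum_children (hA : C.IsMinimizer d a t lam A σ) {k : ℕ} (hk : k < h)
    {q : List (V ⊕ J)} {x : V ⊕ J} (hlen : q.length = 2 * (h - 1 - k))
    (hq : q ++ [x] ∈ C.selectedTree h σ r) :
    ((d : ℝ) - 1)⁻¹ * ∑ᶠ y ∈ children (C.selectedTree h σ r) (q ++ [x]),
        (a k * pathValue J lam r (q ++ [x] ++ [y]) +
          t * ∑ᶠ z ∈ children (C.selectedTree h σ r) (q ++ [x] ++ [y]),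
            edgeValue (A k) z (pathTarget (Sum.inl r) (q ++ [x] ++ [y]))) =
      edgeValue (A (k + 1)) x (pathTarget (Sum.inl r) q) := by
  have hqT := prefixClosed_selectedTree.of_concat hq
  obtain ⟨v, hv⟩ := exists_pathTarget_eq_inl hqT.1 ⟨h - 1 - k, by omega⟩
  obtain ⟨j, rfl⟩ : ∃ j, x = Sum.inr j := by
    obtain ⟨j, hj⟩ := exists_pathTarget_eq_inr hq.1 ⟨h - 1 - k, by simp [hlen]⟩
    rw [pathTarget_concat] at hj
    exact ⟨j, hj⟩
  -- At depth 2(h - 1 - k) the tree uses σ k: the selected variable nodes have depth 2(h - k), with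
  -- k variable levels below them.
  have hidx : h - 1 - q.length / 2 = k := by omega
  have hch := children_selectedTree_of_odd hA.subset hq hv
  rw [hidx] at hch
  rw [hv, edgeValue_inr_inl, hA.succ, hch, finsum_mem_image Sum.inl_injective.injOn,
    finsum_mem_coe_finset]
  congr 1
  refine Finset.sum_congr rfl fun u hu => ?_
  have hu' : q ++ [Sum.inr j] ++ [Sum.inl u] ∈ C.selectedTree h σ r := by
    rw [← mem_children, hch]
    exact ⟨u, hu, rfl⟩
  rw [nodeValue, pathValue, pathTarget_concat, Sum.elim_inl]
  congr 2
  -- For k = 0 the selected nodes are leaves, matching A 0 = 0.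
  rcases Nat.eq_zero_or_pos k with rfl | hk0
  · simp [hA.zero, edgeValue_zero]
  · rw [children_selectedTree_of_even hu' ⟨h - k, by simp; omega⟩,
      children_eq_image_otherNbrs hu'.1 (by omega),
      finsum_mem_image Sum.inr_injective.injOn, finsum_mem_coe_finset]
    rfl

/-- Folds the tree from the leaves upward: the k lowest variable levels are absorbed into the values
A k sitting on the edges just below depth 2(h - k). -/
theorem IsMinimizer.sum_range_level [Finite V] (hA : C.IsMinimizer d a t lam A σ) {k : ℕ} (hk : k ≤ h) :
    ∑ l ∈ Finset.range k, a l * (t ^ (h - l - 1) * ((d : ℝ) - 1)⁻¹ ^ (h - l)) *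
        ∑ᶠ p ∈ level (C.selectedTree h σ r) (2 * (h - l)), pathValue J lam r p =
      (t ^ (h - k) * ((d : ℝ) - 1)⁻¹ ^ (h - k)) *
        ∑ᶠ q ∈ level (C.selectedTree h σ r) (2 * (h - k)),
          ∑ᶠ x ∈ children (C.selectedTree h σ r) q,
            edgeValue (A k) x (pathTarget (Sum.inl r) q) := by
  set τ := C.selectedTree h σ r with hτ
  have hpc : PrefixClosed τ := prefixClosed_selectedTree
  have hfin : τ.Finite := selectedTree_finite
  induction k with
  | zero => simp [hA.zero, edgeValue_zero]
  | succ k ih =>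
    obtain ⟨m, hm⟩ : ∃ m, h = k + (m + 1) := ⟨h - k - 1, by omega⟩
    have e1 : h - k = m + 1 := by omega
    have e2 : h - (k + 1) = m := by omega
    have hlev : ∑ᶠ q ∈ level τ (2 * m), ∑ᶠ x ∈ children τ q,
        edgeValue (A (k + 1)) x (pathTarget (Sum.inl r) q) =
        ((d : ℝ) - 1)⁻¹ * ∑ᶠ q ∈ level τ (2 * (m + 1)), (a k * pathValue J lam r q +
          t * ∑ᶠ x ∈ children τ q, edgeValue (A k) x (pathTarget (Sum.inl r) q)) := by
      rw [show 2 * (m + 1) = 2 * m + 1 + 1 by ring, finsum_level_succ hpc hfin,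
        finsum_level_succ hpc hfin, mul_finsum_mem]
      refine finsum_mem_congr rfl fun q hq => ?_
      rw [mul_finsum_mem]
      refine finsum_mem_congr rfl fun x hx => ?_
      exact (hA.finsum_children (by omega) (by rw [hq.2]; omega) hx).symm
    rw [Finset.sum_range_succ, ih (by omega), e1, e2, hlev,
      finsum_mem_add_distrib (level_finite hfin _), ← mul_finsum_mem,
      ← mul_finsum_mem]
    simp only [Nat.add_sub_cancel]
    ring

/-- The case k = h of the folding, where only the root is left. The factor dL⁻¹ is the part of
`processWeight` not carried by the recursion. -/
theorem IsMinimizer.treeValue_selectedTree [Finite V] {dL : ℕ} {w : Fin h → ℝ} (hh : 0 < h)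
    (hA : C.IsMinimizer d (fun k => levelWeight w (h - k)) ((dL : ℝ) - 1)⁻¹ lam A σ) :
    treeValue (processWeight d dL w) (C.selectedTree h σ r) (pathValue J lam r) =
      (dL : ℝ)⁻¹ * ∑ j, open scoped Classical in if r ∈ C.nbrFinset j then A h j r else 0 := by
  have hfin : (C.selectedTree h σ r).Finite := selectedTree_finite
  have hroot : ∑ᶠ q ∈ level (C.selectedTree h σ r) 0, ∑ᶠ x ∈ children (C.selectedTree h σ r) q,
      edgeValue (A h) x (pathTarget (Sum.inl r) q) =
        ∑ j, open scoped Classical in if r ∈ C.nbrFinset j then A h j r else 0 := by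
    have hlev : level (C.selectedTree h σ r) 0 = {[]} := by
      ext p
      simp only [level, Set.mem_ofPred_eq, List.length_eq_zero_iff, Set.mem_singleton_iff]
      exact ⟨fun h => h.2, fun h => ⟨h ▸ nil_mem_selectedTree, h⟩⟩
    classical
    rw [hlev, finsum_mem_singleton, children_selectedTree_of_even nil_mem_selectedTree (by simp),
      children_nil_pathPrefixTree (by omega), neighborSet_inl,
      finsum_mem_image Sum.inr_injective.injOn, ← Finset.sum_filter,
      ← finsum_mem_coe_finset]
    refine finsum_mem_congr ?_ fun j _ => rfl
    ext j
    simp [mem_nbrFinset]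
  have hsum := hA.sum_range_level (r := r) (le_refl h)
  simp only [Nat.sub_self, pow_zero, one_mul, mul_zero] at hsum
  rw [hroot] at hsum
  rw [← hsum, treeValue_eq_sum_level, Finset.sum_range, Finset.mul_sum]
  refine Finset.sum_congr rfl fun l _ => ?_
  have hl := l.2
  obtain ⟨m, hm⟩ : ∃ m, h = l + (m + 1) := ⟨h - l - 1, by omega⟩
  have e1 : h - l = m + 1 := by omega
  have e2 : ((l : ℕ) : ℤ) - (h : ℤ) + 1 = -(m : ℤ) := by omega
  have e3 : ((l : ℕ) : ℤ) - (h : ℤ) = -((m + 1 : ℕ) : ℤ) := by omega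
  rw [← mul_finsum_mem, ← Nat.mul_sub, processWeight, e2, e3, zpow_neg,
    zpow_neg, zpow_natCast, zpow_natCast, ← inv_pow, ← inv_pow, e1]
  simp only [Nat.add_sub_cancel]
  ring

/-! ### From positive d-trees to the linear program. -/

/-- If all `d`-trees have positive value, then the linear program has `0` as its unique
optimum. -/
theorem isUniqueLPOptimum_zero [Fintype V] {dR dL : ℕ} (hreg : C.IsRegular dL dR) (hd2 : 2 ≤ d)
    (hd : (d : ℕ∞) ≤ C.minLocalDist) (hh : 0 < h) {w : Fin h → ℝ} (hw : ∀ i, 0 ≤ w i)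
    (hpos : ∀ r, ∀ τ ∈ C.dTrees h d r,
      0 < treeValue (processWeight d dL w) τ (pathValue J lam r)) :
    C.IsUniqueLPOptimum lam 0 := by
  classical
  refine ⟨realWord_zero_mem_fundamentalPolytope, fun x hx hx0 => ?_⟩
  rw [realWord_zero] at hx0 ⊢
  simp only [Pi.zero_apply, mul_zero, Finset.sum_const_zero]
  have hxj : ∀ j, x ∈ convexHull ℝ (realWord '' C.extendedLocalCode j) := Set.mem_iInter.1 hx
  obtain ⟨v₀, hv₀⟩ := Function.ne_iff.1 hx0
  have hdegree : ∀ v, ({j | v ∈ C.nbrFinset j} : Finset J).card = dL := fun v => by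
    rw [← hreg.1 v, vertexDeg_inl, ← Set.ncard_coe_finset]
    congr 1
    ext j
    simp [mem_nbrFinset]
  -- A local code without nonzero words puts no constraint on d*. So d ≤ dR is obtained at a
  -- neighbour i of v₀, where x v₀ ≠ 0 provides a nonzero local word, and regularity carries it to
  -- j.
  have hcard : ∀ j, ∀ v ∈ C.nbrFinset j, d ≤ (C.nbrFinset j).card := by
    intro j v hv
    have hne : ({j | v₀ ∈ C.nbrFinset j} : Finset J).Nonempty := by
      rw [← Finset.card_pos, hdegree, ← hdegree v, Finset.card_pos]
      exact ⟨j, by simpa using hv⟩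
    obtain ⟨i, hi⟩ := hne
    obtain ⟨c, hc, hcv⟩ := exists_ne_zero_of_mem_convexHull (hxj i) hv₀
    rw [card_nbrFinset_of_isRegular hreg j, ← card_nbrFinset_of_isRegular hreg i]
    exact (le_card_support hd hc (by simpa using hi) hcv).trans
      (Finset.card_le_card (Finset.filter_subset _ _))
  obtain ⟨A, σ, hA⟩ := exists_isMinimizer hcard (fun k => levelWeight w (h - k))
    ((dL : ℝ) - 1)⁻¹ lam
  have hroot : ∀ r, 0 < (dL : ℝ)⁻¹ * ∑ j, if r ∈ C.nbrFinset j then A h j r else 0 := by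
    intro r
    have := hpos r _ (selectedTree_mem_dTrees (h := h) (r := r) (by omega) hA.subset hA.card)
    rw [hA.treeValue_selectedTree hh] at this
    exact this
  have hdL : 0 < dL := by
    rcases Nat.eq_zero_or_pos dL with h0 | h0
    · have := hroot v₀
      simp [h0] at this
    · exact h0
  have hdL' : (0 : ℝ) < dL := by exact_mod_cast hdL
  obtain ⟨j₀, -⟩ : ({j | v₀ ∈ C.nbrFinset j} : Finset J).Nonempty := by
    rw [← Finset.card_pos, hdegree]; exact hdL
  have hxnn : ∀ v, 0 ≤ x v := nonneg_of_mem_convexHull (hxj j₀)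
  have hxpos : 0 < x v₀ := lt_of_le_of_ne (hxnn v₀) (Ne.symm hv₀)
  have hd1 : (0 : ℝ) < (d : ℝ) - 1 := by
    have : (2 : ℝ) ≤ d := by exact_mod_cast hd2
    linarith
  have hl : ∀ n, 0 ≤ levelWeight w n := fun n => by
    rw [levelWeight]; split_ifs
    · exact hw _
    · exact le_rfl
  have hswap : ∀ f : J → V → ℝ, ∑ j, ∑ v ∈ C.nbrFinset j, f j v =
      ∑ v, ∑ j ∈ {j | v ∈ C.nbrFinset j}, f j v := by
    intro f
    refine Finset.sum_comm' fun j v => ?_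
    simp
  have hstep : ∀ k, ∑ j, ∑ v ∈ C.nbrFinset j, x v * A (k + 1) j v ≤
      dL * levelWeight w (h - k) * ∑ v, lam v * x v + ((dL : ℝ) - 1)⁻¹ * ((dL : ℝ) - 1) *
        ∑ j, ∑ v ∈ C.nbrFinset j, x v * A k j v := by
    intro k
    calc ∑ j, ∑ v ∈ C.nbrFinset j, x v * A (k + 1) j v
        ≤ ∑ j, ∑ v ∈ C.nbrFinset j, x v *
            C.nodeValue (levelWeight w (h - k)) ((dL : ℝ) - 1)⁻¹ lam (A k) j v := by
          refine Finset.sum_le_sum fun j _ => sum_mul_le_of_mem_convexHull hd2 hd (hxj j) _ _ ?_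
          intro v hv S hS hSc
          refine le_trans (le_of_eq ?_) (hA.min k j v hv S hS hSc)
          rw [hA.succ, Nat.cast_sub (by omega), Nat.cast_one, mul_inv_cancel_left₀ hd1.ne']
      _ = _ := by
          rw [hswap, hswap, Finset.mul_sum, Finset.mul_sum, ← Finset.sum_add_distrib]
          refine Finset.sum_congr rfl fun v _ => ?_
          -- Summed over the dL nodes j at v, each A k j' v occurs dL - 1 times, which the factor t
          -- = (dL - 1)⁻¹ is meant to cancel.
          have hother : ∀ j ∈ ({j | v ∈ C.nbrFinset j} : Finset J),
              ∑ j' ∈ C.otherNbrs j v, A k j' v =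
                (∑ j' ∈ ({j | v ∈ C.nbrFinset j} : Finset J), A k j' v) - A k j v := by
            intro j hj
            rw [← Finset.sum_erase_add _ _ hj, add_sub_cancel_right]
            refine Finset.sum_congr ?_ fun _ _ => rfl
            ext j'
            rw [mem_otherNbrs, Finset.mem_erase, Finset.mem_filter, mem_nbrFinset]
            simp [and_comm]
          simp only [nodeValue]
          rw [← Finset.mul_sum, Finset.sum_add_distrib, Finset.sum_const, hdegree,
            ← Finset.mul_sum, Finset.sum_congr rfl hother, Finset.sum_sub_distrib,
            Finset.sum_const, hdegree, ← Finset.mul_sum, nsmul_eq_mul, nsmul_eq_mul]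
          ring
  -- This product is not always 1: it is 0 for dL = 1. Its sign suffices.
  have ht : 0 ≤ ((dL : ℝ) - 1)⁻¹ * ((dL : ℝ) - 1) := by
    have : (1 : ℝ) ≤ dL := by exact_mod_cast hdL
    have : 0 ≤ (dL : ℝ) - 1 := by linarith
    positivity
  have hbound : ∀ k, ∃ s : ℝ, 0 ≤ s ∧
      ∑ j, ∑ v ∈ C.nbrFinset j, x v * A k j v ≤ s * ∑ v, lam v * x v := by
    intro k
    induction k with
    | zero => exact ⟨0, le_rfl, by simp [hA.zero]⟩
    | succ k ih =>
      obtain ⟨s, hs, hle⟩ := ih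
      refine ⟨dL * levelWeight w (h - k) + ((dL : ℝ) - 1)⁻¹ * ((dL : ℝ) - 1) * s,
        add_nonneg (mul_nonneg hdL'.le (hl _)) (mul_nonneg ht hs), (hstep k).trans ?_⟩
      rw [add_mul, mul_assoc _ s]
      exact add_le_add le_rfl (mul_le_mul_of_nonneg_left hle ht)
  obtain ⟨s, hs, hle⟩ := hbound h
  -- Grouped by v, the inner sums are positive because they come from the selected tree rooted at v.
  have htotal : 0 < ∑ j, ∑ v ∈ C.nbrFinset j, x v * A h j v := by
    rw [hswap]
    have hterm : ∀ v, 0 < ∑ j ∈ {j | v ∈ C.nbrFinset j}, A h j v := fun v => by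
      rw [Finset.sum_filter]
      exact pos_of_mul_pos_right (hroot v) (inv_nonneg.2 hdL'.le)
    simp_rw [← Finset.mul_sum]
    exact Finset.sum_pos' (fun v _ => mul_nonneg (hxnn v) (hterm v).le)
      ⟨v₀, Finset.mem_univ _, mul_pos hxpos (hterm v₀)⟩
  exact pos_of_mul_pos_right (htotal.trans_le hle) hs

end TannerCode

/-! ### Comparison of the channel with the process on the regular tree. -/

theorem treeValue_congr {α : Type*} {h : ℕ} (ω : Fin h → ℝ) {τ : Set (List α)}
    {lam lam' : List α → ℝ} (hlam : ∀ p ∈ τ, Even p.length → lam p = lam' p) :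
    treeValue ω τ lam = treeValue ω τ lam' := by
  refine Finset.sum_congr rfl fun l _ => finsum_mem_congr rfl fun p hp => ?_
  rw [hlam p hp.1 ⟨h - l, by have := hp.2; have := l.2; omega⟩]

theorem measurable_treeValue {α Ω : Type*} [MeasurableSpace Ω] {h : ℕ} (ω : Fin h → ℝ)
    {τ : Set (List α)} (hτ : τ.Finite) {X : Ω → List α → ℝ} (hX : ∀ p, Measurable fun z => X z p) :
    Measurable fun z => treeValue ω τ (X z) := by
  unfold treeValue
  refine Finset.measurable_sum _ fun l _ => ?_
  have hfin : {p : List α | p ∈ τ ∧ p.length + 2 * (l : ℕ) = 2 * h}.Finite :=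
    hτ.subset fun p hp => hp.1
  simp_rw [finsum_mem_eq_finite_toFinset_sum _ hfin]
  exact Finset.measurable_sum _ fun p _ => (hX p).const_mul _

/-- `Π(h, ω)` as a probability for the values on the nodes at even depth. -/
theorem processProb_eq (γ : Measure ℝ) [IsProbabilityMeasure γ] (d dL dR h : ℕ) (ω : Fin h → ℝ)
    (E : Set (List ℕ)) (hE : ∀ p ∈ regularTree dL dR (2 * h), Even p.length → p ∈ E) :
    processProb γ d dL dR h ω = (Measure.infinitePi fun _ : E => γ).real
      {z | ∃ τ, IsDTree d (regularTree dL dR (2 * h)) τ ∧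
        treeValue ω τ (fun p => open scoped Classical in if hp : p ∈ E then z ⟨p, hp⟩ else 0) ≤ 0} := by
  classical
  set B : Set (E → ℝ) := {z | ∃ τ, IsDTree d (regularTree dL dR (2 * h)) τ ∧
    treeValue ω τ (fun p => if hp : p ∈ E then z ⟨p, hp⟩ else 0) ≤ 0} with hB
  have hfin := regularTree_finite dL dR (2 * h)
  have hmeas : MeasurableSet B := by
    -- The finite regular tree has finitely many d-trees, so this is a finite union of measurable
    -- events.
    have : B = ⋃ τ ∈ {τ | IsDTree d (regularTree dL dR (2 * h)) τ},
        {z : E → ℝ | treeValue ω τ (fun p => if hp : p ∈ E then z ⟨p, hp⟩ else 0) ≤ 0} := by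
      ext z; simp [hB]
    rw [this]
    refine Set.Finite.measurableSet_biUnion
      (hfin.finite_subsets.subset fun τ hτ => hτ.subset) fun τ hτ => ?_
    refine measurableSet_le (measurable_treeValue ω (hfin.subset hτ.subset) fun p => ?_)
      measurable_const
    by_cases hp : p ∈ E
    · simpa [hp] using measurable_pi_apply _
    · simp [hp]
  have hmap := Measure.map_infinitePi_infinitePi_of_inj (P := fun _ : List ℕ => γ)
    (Subtype.val_injective (p := (· ∈ E)))
  rw [processProb, ← hmap, map_measureReal_apply (by fun_prop) hmeas]
  congr 1
  ext lam
  simp only [hB, Set.preimage_ofPred_eq, Set.mem_ofPred_eq]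
  refine exists_congr fun τ => and_congr_right fun hτ => ?_
  rw [treeValue_congr ω fun p hp heven => ?_]
  rw [dif_pos (hE p (hτ.subset hp) heven)]

namespace TannerCode

variable {V J : Type*} {C : TannerCode V J}

theorem measureReal_exists_dTree_le [Fintype V] [Finite J] {dL dR : ℕ}
    (hreg : C.IsRegular dL dR) (d h : ℕ) (hgirth : ((4 * h : ℕ) : ℕ∞) < C.graph.egirth)
    (ch : MBIOSChannel) (ω : Fin h → ℝ) (r : V) :
    (ch.wordLaw (0 : V → ZMod 2)).real {y | ∃ τ ∈ C.dTrees h d r,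
      treeValue ω τ (pathValue J (fun v => ch.llr (y v)) r) ≤ 0} ≤
      processProb ch.llrLaw d dL dR h ω := by
  classical
  obtain ⟨φ, hφ⟩ := C.exists_treeIso_regularTree hreg r (2 * h)
  set R := regularTree dL dR (2 * h)
  let E : Set (List ℕ) := {p | p ∈ R ∧ Even p.length}
  have htarget : ∀ p : E, ∃ v, pathTarget (Sum.inl r) (φ p) = Sum.inl v := fun p =>
    exists_pathTarget_eq_inl (hφ.bijOn.mapsTo p.2.1) (by rw [hφ.length_map]; exact p.2.2)
  choose g hg using htarget
  -- The girth enters here: distinct even nodes read distinct received symbols, so the product law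
  -- pushes forward to a product law.
  have hginj : Function.Injective g := by
    intro p q hpq
    refine Subtype.ext (hφ.bijOn.injOn p.2.1 q.2.1 ?_)
    refine injOn_pathTarget (G := C.graph) (r := Sum.inl r) (k := 2 * h) ?_
      (hφ.bijOn.mapsTo p.2.1) (hφ.bijOn.mapsTo q.2.1) (by rw [hg, hg, hpq])
    rwa [← mul_assoc]
  have hword : ch.wordLaw (0 : V → ZMod 2) = Measure.infinitePi fun _ : V => ch.symbolLaw 0 :=
    (Measure.infinitePi_eq_pi (μ := fun _ : V => ch.symbolLaw 0)).symm
  let f : (V → ℝ) → E → ℝ := fun y p => ch.llr (y (g p))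
  have hf : Measurable f :=
    measurable_pi_lambda _ fun p => ch.measurable_llr.comp (measurable_pi_apply _)
  have hmap : (ch.wordLaw (0 : V → ZMod 2)).map f = Measure.infinitePi fun _ : E => ch.llrLaw := by
    have h1 := Measure.map_infinitePi_infinitePi_of_inj (P := fun _ : V => ch.symbolLaw 0) hginj
    have h2 := Measure.infinitePi_map_pi (fun _ : E => ch.symbolLaw 0)
      (f := fun _ => ch.llr) fun _ => ch.measurable_llr
    have h3 : Measurable fun (x : E → ℝ) i => ch.llr (x i) :=
      measurable_pi_lambda _ fun p => ch.measurable_llr.comp (measurable_pi_apply p)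
    rw [← h1, Measure.map_map h3 (by fun_prop)] at h2
    rw [hword]
    exact h2
  rw [processProb_eq ch.llrLaw d dL dR h ω E fun p hp he => ⟨hp, he⟩, ← hmap]
  have : IsProbabilityMeasure (ch.wordLaw (0 : V → ZMod 2)) := by rw [hword]; infer_instance
  have := Measure.isProbabilityMeasure_map (μ := ch.wordLaw (0 : V → ZMod 2)) hf.aemeasurable
  -- Only an upper bound is needed: the bad event lies in the preimage of the process event, and
  -- `Measure.le_map_apply` requires no measurability of that event.
  refine ENNReal.toReal_mono (measure_ne_top _ _) (le_trans (measure_mono ?_)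
    (Measure.le_map_apply hf.aemeasurable _))
  rintro y ⟨τ, hτ, hle⟩
  refine ⟨R ∩ φ ⁻¹' τ, hφ.isDTree_subtree (prefixClosed_regularTree _ _ _)
    (prefixClosed_pathPrefixTree _ _ _) (nil_mem_regularTree _ _ _) (regularTree_finite _ _ _)
    (pathPrefixTree_finite _ _ _) hτ, ?_⟩
  rw [← hφ.treeValue_subtree hτ.subset] at hle
  rw [treeValue_congr ω fun p hp heven => ?_]
  · exact hle
  · rw [dif_pos (show p ∈ E from ⟨hp.1, heven⟩), Function.comp_apply, pathValue,
      hg ⟨p, hp.1, heven⟩, Sum.elim_inl]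

end TannerCode

end TannerLP

/-! ### Union bound over the roots. -/

theorem mainTheorem7 {V J : Type*} [Fintype V] [Fintype J] (C : TannerLP.TannerCode V J)
    (dL dR : ℕ) (hreg : C.IsRegular dL dR)
    (d : ℕ) (hd : 2 ≤ d) (hd_le : (d : ℕ∞) ≤ C.minLocalDist)
    (h : ℕ) (w : Fin h → ℝ) (hw_nonneg : ∀ i, 0 ≤ w i) (hw_ne : w ≠ 0)
    (hgirth : ((4 * h : ℕ) : ℕ∞) < C.graph.egirth)
    (ch : TannerLP.MBIOSChannel) :
    1 - (Fintype.card V : ℝ) *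
          TannerLP.processProb ch.llrLaw d dL dR h (TannerLP.processWeight d dL w)
        ≤ (ch.wordLaw (0 : V → ZMod 2)).real
            {y | C.IsLocallyOptimal w d (fun v => ch.llr (y v)) 0} ∧
    1 - (Fintype.card V : ℝ) *
          TannerLP.processProb ch.llrLaw d dL dR h (TannerLP.processWeight d dL w)
        ≤ (ch.wordLaw (0 : V → ZMod 2)).real
            {y | C.IsUniqueLPOptimum (fun v => ch.llr (y v)) 0} := by
  classical
  have : IsProbabilityMeasure (ch.wordLaw (0 : V → ZMod 2)) := by
    unfold TannerLP.MBIOSChannel.wordLaw; infer_instance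
  -- For h = 0 the only weight vector is 0.
  have hh : 0 < h := by
    rcases Nat.eq_zero_or_pos h with rfl | h0
    · exact absurd (Subsingleton.elim _ _) hw_ne
    · exact h0
  have hloc := fun lam => TannerLP.TannerCode.isLocallyOptimal_zero_iff hreg (d := d) (by omega)
    hw_nonneg hw_ne lam
  have hfirst : 1 - (Fintype.card V : ℝ) *
      TannerLP.processProb ch.llrLaw d dL dR h (TannerLP.processWeight d dL w)
      ≤ (ch.wordLaw (0 : V → ZMod 2)).real
          {y | C.IsLocallyOptimal w d (fun v => ch.llr (y v)) 0} := by
    set good := {y : V → ℝ | C.IsLocallyOptimal w d (fun v => ch.llr (y v)) 0} with hgood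
    let bad : V → Set (V → ℝ) := fun r => {y | ∃ τ ∈ C.dTrees h d r,
      TannerLP.treeValue (TannerLP.processWeight d dL w) τ
        (TannerLP.TannerCode.pathValue J (fun v => ch.llr (y v)) r) ≤ 0}
    -- Covering the whole space and using subadditivity avoids any measurability claim about `good`.
    have hcover : good ∪ ⋃ r, bad r = Set.univ := by
      refine Set.eq_univ_of_forall fun y => ?_
      by_cases hy : y ∈ good
      · exact Or.inl hy
      · right
        rw [hgood, Set.mem_ofPred_eq, hloc] at hy
        push Not at hy
        obtain ⟨r, τ, hτ, hle⟩ := hy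
        exact Set.mem_iUnion.2 ⟨r, τ, hτ, hle⟩
    have h1 : 1 ≤ (ch.wordLaw (0 : V → ZMod 2)).real good +
        (ch.wordLaw (0 : V → ZMod 2)).real (⋃ r, bad r) := by
      rw [← probReal_univ (μ := ch.wordLaw (0 : V → ZMod 2)), ← hcover]
      exact measureReal_union_le _ _
    have h2 : (ch.wordLaw (0 : V → ZMod 2)).real (⋃ r, bad r) ≤ (Fintype.card V : ℝ) *
        TannerLP.processProb ch.llrLaw d dL dR h (TannerLP.processWeight d dL w) := by
      refine (measureReal_iUnion_fintype_le _).trans ((Finset.sum_le_sum fun r _ =>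
        TannerLP.TannerCode.measureReal_exists_dTree_le hreg d h hgirth ch _ r).trans ?_)
      simp
    linarith
  refine ⟨hfirst, hfirst.trans (measureReal_mono fun y hy => ?_)⟩
  exact TannerLP.TannerCode.isUniqueLPOptimum_zero hreg hd hd_le hh hw_nonneg ((hloc _).1 hy)
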